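/- Let $\Sigma$ be a compact connected Riemann surface, let $V=\Sigma\times\mathbb C^2$ with standard real structure $\rho$, and let $\nabla=d+A$ be a flat irreducible ${\rm SL}(2,\mathbb C)$-connection on $V$ (that is, $A$ is a smooth trace-free matrix valued one-form, $\nabla$ is flat and has no invariant line subbundle). Let $S\subset V$ be a line subbundle that is holomorphic with respect to $\bar\partial^\nabla$ and whose second fundamental form $\varphi\colon S\to K\otimes V/S$ vanishes nowhere (so $(\nabla,S)$ is an oper), and suppose that $\nabla$ has real monodromy, i.e. its monodromy group is conjugate in ${\rm GL}(2,\mathbb C)$ to a subgroup of ${\rm SU}(1,1)$. These are the data of a grafting section $\lambda\mapsto[\lambda,\bar\partial^{\nabla^\lambda},\lambda\partial^{\nabla^\lambda}]$, where $\nabla^\lambda=\nabla.g(\lambda)$ and $g(\lambda)=\begin{pmatrix}1&0\\0&\lambda\end{pmatrix}$ with respect to a smooth splitting $V=S\oplus L$. Then there is a smooth $\nabla$-parallel indefinite Hermitian metric $\langle\cdot,\cdot\rangle$ on $V$ and a smooth map $h\colon\Sigma\to{\rm SL}(2,\mathbb C)$ with $\bar\nabla=\nabla.h$, where $\nabla.h=h^{-1}\circ\nabla\circ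 h$ and $\bar\nabla=\rho\circ\nabla\circ\rho$. For every such metric and every such $h$, let $S^\#\subset V$ be the orthogonal complement of $S$ with respect to $\langle\cdot,\cdot\rangle$, and for a smooth complementary line subbundle $L$ of $S$ put $$\tilde g_p(\lambda)=g_p(\lambda)^{-1}\,h(p)\,\overline{g_p(-\bar\lambda^{-1})},\qquad \lambda\in\mathbb C^*,\ p\in\Sigma .$$ Then: 1. For every smooth complementary line subbundle $L$ of $S$ and every $p\in\Sigma$ with $S_p\neq S^\#_p$, the loop $\lambda\mapsto\tilde g_p(\lambda)$ lies in the big cell, that is, $\tilde g_p(\lambda)=\lambda^k g^+(\lambda)g^-(\lambda)$ for some $k\in\mathbb Z$, with $g^+$ holomorphic and ${\rm GL}(2,\mathbb C)$-valued on $\mathbb C$ and $g^-$ holomorphic and ${\rm GL}(2,\mathbb C)$-valued on $\mathbb{CP}^1\setminus\{0\}$. 2. The set $U=\{p\in\Sigma\mid S_p\neq S^\#_p\}$ is open and dense in $\Sigma$. -/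

import Mathlib

open Set Filter Topology Matrix
open scoped Manifold ContDiff ComplexConjugate

noncomputable section

namespace Oper

/-- A fibre of the trivialised rank two complex vector bundle `V = X × ℂ²`. -/
abbrev Fib : Type := Fin 2 → ℂ

/-- Endomorphisms of a fibre of `V`. -/
abbrev Mat : Type := Matrix (Fin 2) (Fin 2) ℂ

/-- Entrywise complex conjugation, `M ↦ ρ ∘ M ∘ ρ` for the standard real structure `ρ` of `ℂ²`. -/
def conjMat (M : Mat) : Mat := M.map (starRingEnd ℂ)

section Surface

variable (X : Type*) [TopologicalSpace X] [ChartedSpace ℂ X]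

/-- Complex matrix valued (real) one-forms on the surface `X`. A form `A` stands for the connection
`∇ = d + A` on `V`. -/
abbrev MatForm : Type _ := ∀ p : X, TangentSpace 𝓘(ℝ, ℂ) p →ₗ[ℝ] Mat

variable {X}

/-- The almost complex structure of a Riemann surface: multiplication by `i` in the preferred
chart at `p` (hence in every holomorphic chart). -/
def complexStr (p : X) : TangentSpace 𝓘(ℝ, ℂ) p →L[ℝ] TangentSpace 𝓘(ℝ, ℂ) p :=
  (Complex.I • ContinuousLinearMap.id ℝ ℂ : ℂ →L[ℝ] ℂ)

/-- The pull-back of a matrix valued one-form along the inverse of the chart at `x₀`. -/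
def inChart (A : MatForm X) (x₀ : X) (z v : ℂ) : Mat :=
  A ((chartAt ℂ x₀).symm z) (mfderiv 𝓘(ℝ, ℂ) 𝓘(ℝ, ℂ) (chartAt ℂ x₀).symm z v)

/-- `A` is a smooth one-form. -/
def IsSmoothForm (A : MatForm X) : Prop :=
  ∀ (x₀ : X) (v : ℂ) (i j : Fin 2),
    ContDiffOn ℝ ∞ (fun z => inChart A x₀ z v i j) (chartAt ℂ x₀).target

/-- The connection `d + A` is flat: `dA + A ∧ A = 0`. -/
def IsFlat (A : MatForm X) : Prop :=
  ∀ x₀ : X, ∀ z ∈ (chartAt ℂ x₀).target, ∀ (u v : ℂ) (i j : Fin 2),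
    fderiv ℝ (fun w => inChart A x₀ w v i j) z u - fderiv ℝ (fun w => inChart A x₀ w u i j) z v
      + (inChart A x₀ z u * inChart A x₀ z v - inChart A x₀ z v * inChart A x₀ z u) i j = 0

/-- `d + A` induces the trivial connection on `Λ²V`. -/
def IsTraceFree (A : MatForm X) : Prop :=
  ∀ (p : X) (v : TangentSpace 𝓘(ℝ, ℂ) p), (A p v).trace = 0

/-- The derivative `ds(v)` at `p` of a section `s` of `V`. -/
def dSec (s : X → Fib) (p : X) (v : TangentSpace 𝓘(ℝ, ℂ) p) : Fib :=
  mfderiv 𝓘(ℝ, ℂ) 𝓘(ℝ, Fib) s p v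

/-- The matrix valued function `F` is smooth. -/
def IsSmoothMat (F : X → Mat) : Prop :=
  ∀ i j : Fin 2, ContMDiff 𝓘(ℝ, ℂ) 𝓘(ℝ, ℂ) ∞ (fun q => F q i j)

/-- The derivative `dF(v)` at `p` of a matrix valued function `F`, taken entrywise. -/
def dMat (F : X → Mat) (p : X) (v : TangentSpace 𝓘(ℝ, ℂ) p) : Mat :=
  Matrix.of fun i j => mfderiv 𝓘(ℝ, ℂ) 𝓘(ℝ, ℂ) (fun q => F q i j) p v

/-- The covariant derivative `∇_v s = ds(v) + A(v) s` at `p`. -/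
def covDeriv (A : MatForm X) (s : X → Fib) (p : X) (v : TangentSpace 𝓘(ℝ, ℂ) p) : Fib :=
  dSec s p v + A p v *ᵥ s p

/-- `S` is a smooth complex line subbundle of `V`: near every point it is spanned by a nowhere
vanishing smooth section of `V`. -/
def IsLineSubbundle (S : X → Submodule ℂ Fib) : Prop :=
  ∀ p : X, ∃ (W : Set X) (s : X → Fib), IsOpen W ∧ p ∈ W ∧
    ContMDiffOn 𝓘(ℝ, ℂ) 𝓘(ℝ, Fib) ∞ s W ∧
    ∀ q ∈ W, s q ≠ 0 ∧ S q = Submodule.span ℂ {s q}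

/-- `s` is a smooth section of `S` in a neighbourhood of `p`. -/
def IsLocalSection (S : X → Submodule ℂ Fib) (s : X → Fib) (p : X) : Prop :=
  (∀ᶠ q in 𝓝 p, s q ∈ S q) ∧ ∀ᶠ q in 𝓝 p, ContMDiffAt 𝓘(ℝ, ℂ) 𝓘(ℝ, Fib) ∞ s q

/-- `S` is a holomorphic subbundle of `(V, ∂̄^∇)`: it is invariant under
`(∂̄^∇ s)(v) = (∇_v s + i ∇_{iv} s) / 2`. -/
def IsHolomorphicSub (A : MatForm X) (S : X → Submodule ℂ Fib) : Prop :=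
  ∀ (p : X) (s : X → Fib), IsLocalSection S s p → ∀ v : TangentSpace 𝓘(ℝ, ℂ) p,
    (1 / 2 : ℂ) • (covDeriv A s p v + Complex.I • covDeriv A s p (complexStr p v)) ∈ S p

/-- The second fundamental form `φ : S → K ⊗ V/S`, `s ↦ ∇s mod S`, vanishes nowhere. -/
def SecondFormNowhereZero (A : MatForm X) (S : X → Submodule ℂ Fib) : Prop :=
  ∀ (p : X) (s : X → Fib), IsLocalSection S s p → s p ≠ 0 →
    ∃ v : TangentSpace 𝓘(ℝ, ℂ) p, covDeriv A s p v ∉ S p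

/-- `S` is invariant under `∇`. -/
def IsParallelSub (A : MatForm X) (S : X → Submodule ℂ Fib) : Prop :=
  ∀ (p : X) (s : X → Fib), IsLocalSection S s p → ∀ v : TangentSpace 𝓘(ℝ, ℂ) p,
    covDeriv A s p v ∈ S p

/-- `d + A` is irreducible: it has no invariant line subbundle. (An invariant line subbundle of a
flat connection has degree zero, so for flat connections this is stability.) -/
def IsIrreducibleConn (A : MatForm X) : Prop :=
  ∀ ℓ : X → Submodule ℂ Fib, IsLineSubbundle ℓ → ¬ IsParallelSub A ℓ

/-- `IsTransport A p q M`: parallel transport of `d + A` along some piecewise `C¹` path from `p` to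
`q` is `M`. Along a `C¹` path `γ` it is the value at `1` of the solution of
`ψ' = - A(γ') ψ`, `ψ(0) = 1`; for a concatenation of paths it is the product. -/
inductive IsTransport (A : MatForm X) : X → X → Mat → Prop
  | path (γ : ℝ → X) (ψ : ℝ → Mat)
      (hγ : ContMDiffOn 𝓘(ℝ, ℝ) 𝓘(ℝ, ℂ) 1 γ (Icc 0 1))
      (h0 : ψ 0 = 1)
      (hψ : ∀ t ∈ Icc (0 : ℝ) 1, ∀ i j : Fin 2, HasDerivWithinAt (fun u => ψ u i j)
        ((-(A (γ t) (mfderivWithin 𝓘(ℝ, ℝ) 𝓘(ℝ, ℂ) γ (Icc 0 1) t (1 : ℝ)) * ψ t)) i j)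
        (Icc 0 1) t) :
      IsTransport A (γ 0) (γ 1) (ψ 1)
  | trans {p q r : X} {M N : Mat} (hM : IsTransport A p q M) (hN : IsTransport A q r N) :
      IsTransport A p r (N * M)

/-- The group `SU(1,1)`, as a set of matrices. -/
def SU11 : Set Mat :=
  {M | Mᴴ * !![1, 0; 0, -1] * M = !![1, 0; 0, -1] ∧ M.det = 1}

/-- `d + A` has real monodromy: its monodromy group at a base point (parallel transports along
closed paths) is conjugate to a subgroup of `SU(1,1)`. -/
def HasRealMonodromy (A : MatForm X) : Prop :=
  ∃ (p₀ : X) (T : GL (Fin 2) ℂ), ∀ M : Mat, IsTransport A p₀ p₀ M →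
    ((T⁻¹ : GL (Fin 2) ℂ) : Mat) * M * (T : Mat) ∈ SU11

/-- `(d + A, S)` is an oper with real monodromy: `d + A` is a flat irreducible `SL(2,ℂ)`-connection
with real monodromy, and `S` is a holomorphic line subbundle whose second fundamental form
vanishes nowhere. -/
structure IsRealOper (A : MatForm X) (S : X → Submodule ℂ Fib) : Prop where
  smooth : IsSmoothForm A
  traceFree : IsTraceFree A
  flat : IsFlat A
  irreducible : IsIrreducibleConn A
  lineSubbundle : IsLineSubbundle S
  holomorphic : IsHolomorphicSub A S
  secondForm : SecondFormNowhereZero A S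
  realMonodromy : HasRealMonodromy A

/-- `H` is a parallel indefinite Hermitian metric `⟨u, w⟩ = u* H w` on `V`, that is, an
`SU(1,1)`-structure for `d + A`. A Hermitian `2 × 2` matrix has signature `(1,1)` exactly when its
(real) determinant is negative, and `dH = A* H + H A` says that `H` is parallel. -/
structure IsParallelMetric (A : MatForm X) (H : X → Mat) : Prop where
  smooth : IsSmoothMat H
  hermitian : ∀ p, (H p).IsHermitian
  indefinite : ∀ p, (H p).det.re < 0
  parallel : ∀ (p : X) (v : TangentSpace 𝓘(ℝ, ℂ) p),
    dMat H p v = (A p v)ᴴ * H p + H p * A p v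

/-- `S^#`: the orthogonal complement of `S` with respect to `H`. -/
def sharp (H : X → Mat) (S : X → Submodule ℂ Fib) (p : X) : Submodule ℂ Fib where
  carrier := {w | ∀ u ∈ S p, star u ⬝ᵥ (H p *ᵥ w) = 0}
  zero_mem' := by intro u _; simp
  add_mem' := by
    intro a b ha hb u hu
    rw [Matrix.mulVec_add, dotProduct_add, ha u hu, hb u hu, add_zero]
  smul_mem' := by
    intro c a ha u hu
    rw [Matrix.mulVec_smul, dotProduct_smul, ha u hu, smul_zero]

/-- `h` is a smooth `SL(2,ℂ)`-valued gauge transformation with `∇̄ = ∇.h`, where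
`∇.h = h⁻¹ ∘ ∇ ∘ h = d + h⁻¹ A h + h⁻¹ dh` and `∇̄ = d + Ā`. -/
structure IsRealityGauge (A : MatForm X) (h : X → Mat) : Prop where
  smooth : IsSmoothMat h
  det_eq_one : ∀ p, (h p).det = 1
  gauge : ∀ (p : X) (v : TangentSpace 𝓘(ℝ, ℂ) p),
    conjMat (A p v) = (h p)⁻¹ * A p v * h p + (h p)⁻¹ * dMat h p v

end Surface

/-- The endomorphism of `ℂ² = S ⊕ L` with matrix `diag(1, μ)`. -/
def splitGauge {S L : Submodule ℂ Fib} (hc : IsCompl S L) (μ : ℂ) : Mat :=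
  LinearMap.toMatrix' (Submodule.projection S L hc + μ • Submodule.projection L S hc.symm)

/-- For `S ⊕ L = ℂ²`, `g(μ) = diag(1, μ)` and `h ∈ SL(2,ℂ)`, the loop
`g̃(μ) = g(μ)⁻¹ h \overline{g(- μ̄⁻¹)}`, `μ ∈ ℂ*`. -/
def gaugeLoop {S L : Submodule ℂ Fib} (hc : IsCompl S L) (h : Mat) (μ : ℂ) : Mat :=
  (splitGauge hc μ)⁻¹ * h * conjMat (splitGauge hc (-(conj μ)⁻¹))

/-- The holomorphic loop `γ : ℂ* → GL(2,ℂ)` lies in the big cell: up to a central loop `μ ^ k`, it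
has a Birkhoff factorisation `γ = g⁺ g⁻` with `g⁺` holomorphic and invertible on `ℂ` and
`g⁻(μ) = Q(μ⁻¹)` holomorphic and invertible on `ℂℙ¹ \ {0}`. The integer `k` is determined by the
winding number of `det γ`, and `k = 0` for loops in `SL(2,ℂ)`. -/
def InBigCell (γ : ℂ → Mat) : Prop :=
  ∃ (k : ℤ) (P Q : ℂ → Mat), (∀ i j, Differentiable ℂ fun μ => P μ i j) ∧
    (∀ i j, Differentiable ℂ fun μ => Q μ i j) ∧
    (∀ μ, (P μ).det ≠ 0) ∧ (∀ μ, (Q μ).det ≠ 0) ∧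
    ∀ μ : ℂ, μ ≠ 0 → γ μ = μ ^ k • (P μ * Q μ⁻¹)

end Oper

end

/-! Write `ε` for the matrix `symp` and `⟨u, w⟩ = u* H w`. The key fact is that a reality gauge `h`
is a scalar multiple of `H⁻¹ε`, whichever parallel metric `H` is chosen.

Existence of `H`: real monodromy gives an indefinite Hermitian form on one fibre that is invariant
under transport along loops; carrying it to the other fibres is independent of the path, and in a
local parallel frame its matrix is constant (`exists_isParallelMetric`). Existence of `h`: a
trace-free matrix satisfies `Mᵀε = -εM`, so parallelism of `H` says that `H⁻¹ε` intertwines `∇̄` and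
`∇`. As `det H` is constant, a constant factor normalises the determinant to `1`
(`exists_isRealityGauge_of_metric`). Two reality gauges differ by a parallel endomorphism, which is
scalar by irreducibility (`IsParallelEnd.eq_scalar`); hence `h = c H⁻¹ε` in all cases.

Big cell: in a basis `s, l` adapted to `S ⊕ L` the loop becomes `diag(1, μ⁻¹) m diag(1, -μ⁻¹)` up to
constant invertible factors, and it factorises explicitly when `m₁₀ ≠ 0`. If `m₁₀ = 0`, then `h s̄ =
m₀₀ s` with `m₀₀ ≠ 0`, while `⟨s, h s̄⟩` is a multiple of `s* ε s̄ = 0`. So `⟨s, s⟩ = 0`, which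
means `S = S^#` at that point.

Density: if `⟨s, s⟩ = 0` on an open set, then `⟨s, ∇_v s⟩` is imaginary for every `v`.
Holomorphicity of `S` gives `⟨s, ∇_v s⟩ = -i ⟨s, ∇_{iv} s⟩`, which is real. Thus `∇s` takes values
in `S^# = S`, contradicting the nowhere vanishing second fundamental form.

The analytic input is the existence of local parallel frames for a flat connection, obtained from
`exists_parallel_section`. -/

noncomputable section

namespace Oper

/-! ### Frobenius-type integrability for linear systems `df = θ f`. -/

section FlatSections

variable {V E : Type*} [NormedAddCommGroup V] [NormedSpace ℝ V]
  [NormedAddCommGroup E] [NormedSpace ℝ E]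

/-- A `C²` map satisfies uniform first and second order Taylor estimates on a small ball. -/
theorem exists_taylor_bounds {θ : V → E} {c : V} (hθ : ContDiffAt ℝ 2 θ c) :
    ∃ K : ℝ, 0 < K ∧ ∃ r : ℝ, 0 < r ∧ (∀ z ∈ Metric.ball c r, DifferentiableAt ℝ θ z ∧ ‖θ z‖ ≤ K) ∧
      ∀ z ∈ Metric.ball c r, ∀ w ∈ Metric.ball c r, ‖θ w - θ z‖ ≤ K * ‖w - z‖ ∧
        ‖θ w - θ z - fderiv ℝ θ z (w - z)‖ ≤ K * ‖w - z‖ ^ 2 := by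
  have h1 : ContDiffAt ℝ 1 (fderiv ℝ θ) c := hθ.fderiv_right (by norm_num)
  obtain ⟨K₁, t, ht, hK₁⟩ := h1.exists_lipschitzOnWith
  have hd : ∀ᶠ z in 𝓝 c, DifferentiableAt ℝ θ z := by
    filter_upwards [hθ.eventually (by simp)] with z hz
    exact hz.differentiableAt (by norm_num)
  have hb : ∀ᶠ z in 𝓝 c, ‖θ z‖ < ‖θ c‖ + 1 :=
    hθ.continuousAt.norm.eventually_lt continuousAt_const (by simp)
  have hb' : ∀ᶠ z in 𝓝 c, ‖fderiv ℝ θ z‖ < ‖fderiv ℝ θ c‖ + 1 :=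
    h1.continuousAt.norm.eventually_lt continuousAt_const (by simp)
  obtain ⟨r, hr, hball⟩ := Metric.eventually_nhds_iff_ball.1 (hd.and (hb.and (hb'.and ht)))
  -- The sum dominates at once the Lipschitz constant of the derivative, a bound for `θ` and a bound
  -- for its derivative, so one constant serves all estimates.
  set K : ℝ := (K₁ : ℝ) + (‖θ c‖ + 1) + (‖fderiv ℝ θ c‖ + 1) with hK
  have e1 : (0 : ℝ) ≤ K₁ := K₁.2
  have e2 := norm_nonneg (θ c)
  have e3 := norm_nonneg (fderiv ℝ θ c)
  refine ⟨K, by linarith, r, hr, fun z hz => ⟨(hball z hz).1, ?_⟩, fun z hz w hw => ⟨?_, ?_⟩⟩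
  · linarith [(hball z hz).2.1]
  · refine (convex_ball c r).norm_image_sub_le_of_norm_fderiv_le (𝕜 := ℝ)
      (fun x hx => (hball x hx).1) (fun x hx => ?_) hz hw
    linarith [(hball x hx).2.2.1]
  · have hseg : segment ℝ z w ⊆ Metric.ball c r := (convex_ball c r).segment_subset hz hw
    have := (convex_segment z w).norm_image_sub_le_of_norm_fderiv_le' (𝕜 := ℝ) (f := θ)
      (C := K * ‖w - z‖) (φ := fderiv ℝ θ z)
      (fun x hx => (hball x (hseg hx)).1) (fun x hx => ?_) (left_mem_segment ℝ z w)
      (right_mem_segment ℝ z w)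
    · calc _ ≤ K * ‖w - z‖ * ‖w - z‖ := this
        _ = _ := by ring
    · have h2 := hK₁.dist_le_mul x (hball x (hseg hx)).2.2.2 z (hball z hz).2.2.2
      rw [dist_eq_norm, dist_eq_norm] at h2
      have h3 : ‖x - z‖ ≤ ‖w - z‖ := by
        rw [← dist_eq_norm, ← dist_eq_norm, dist_comm x, dist_comm w]
        obtain ⟨a, b, ha, hb, hab, rfl⟩ := hx
        have : a • z + b • w - z = b • (w - z) := by
          rw [eq_sub_of_add_eq hab]; module
        rw [dist_comm, dist_eq_norm, this, norm_smul, Real.norm_of_nonneg hb, dist_comm,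
          dist_eq_norm]
        exact mul_le_of_le_one_left (norm_nonneg _) (by linarith)
      calc _ ≤ K₁ * ‖x - z‖ := h2
        _ ≤ K * ‖w - z‖ := by gcongr; linarith

theorem hasDerivAt_add_smul (c u : V) (t : ℝ) : HasDerivAt (fun t : ℝ => c + t • u) u t := by
  simpa using ((hasDerivAt_id t).smul_const u).const_add c

theorem hasDerivAt_comp_line {F : Type*} [NormedAddCommGroup F] [NormedSpace ℝ F] {θ : V → F}
    {c u : V} {t : ℝ} (h : DifferentiableAt ℝ θ (c + t • u)) :
    HasDerivAt (fun t : ℝ => θ (c + t • u)) (fderiv ℝ θ (c + t • u) u) t :=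
  HasFDerivAt.comp_hasDerivAt (f := fun t : ℝ => c + t • u) t h.hasFDerivAt
    (hasDerivAt_add_smul c u t)

theorem hasDerivAt_comp_line_apply {F : Type*} [NormedAddCommGroup F] [NormedSpace ℝ F]
    {θ : V → V →L[ℝ] F} {c u : V} {t : ℝ} (h : DifferentiableAt ℝ θ (c + t • u)) (w : V) :
    HasDerivAt (fun t : ℝ => θ (c + t • u) w) (fderiv ℝ θ (c + t • u) u w) t :=
  HasFDerivAt.comp_hasDerivAt t (ContinuousLinearMap.apply ℝ F w).hasFDerivAt
    (hasDerivAt_comp_line h)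

theorem hasDerivWithinAt_smul_clm_apply {g : ℝ → E →L[ℝ] E} {g' : E →L[ℝ] E} {ψ : ℝ → E} {e : E}
    {t : ℝ} {s : Set ℝ} (hg : HasDerivAt g g' t) (hψ : HasDerivWithinAt ψ e s t) :
    HasDerivWithinAt (fun t => t • g t (ψ t)) (t • (g' (ψ t) + g t e) + (1 : ℝ) • g t (ψ t)) s t :=
  (hasDerivWithinAt_id t s).smul (hg.hasDerivWithinAt.clm_apply hψ)

/-- A linear ordinary differential equation on `[0, 1]` with small coefficients is solvable. -/
theorem exists_linear_ode_solution [CompleteSpace E] {a : ℝ → E →L[ℝ] E}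
    (ha : ContinuousOn a (Icc 0 1)) (hb : ∀ t ∈ Icc (0 : ℝ) 1, ‖a t‖ ≤ 1 / 2) (e₀ : E) :
    ∃ ψ : ℝ → E, ψ 0 = e₀ ∧
      ∀ t ∈ Icc (0 : ℝ) 1, HasDerivWithinAt ψ (a t (ψ t)) (Icc 0 1) t := by
  -- On the ball of radius `‖e₀‖` about `e₀` one has `‖x‖ ≤ 2‖e₀‖`, so the speed is at most `‖e₀‖`
  -- and a solution cannot leave the ball within unit time.
  have h : IsPicardLindelof (fun t x => a t x) (⟨0, by simp⟩ : Icc (0 : ℝ) 1) e₀ ‖e₀‖₊ 0 ‖e₀‖₊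
      1 := by
    refine ⟨fun t ht => ?_, fun x _ => ha.clm_apply continuousOn_const, fun t ht x hx => ?_, ?_⟩
    · refine ((a t).lipschitz.weaken ?_).lipschitzOnWith
      rw [← NNReal.coe_le_coe]
      simpa using (hb t ht).trans (by norm_num)
    · have h1 : ‖x‖ ≤ 2 * ‖e₀‖ := by
        have := norm_le_norm_add_norm_sub' x e₀
        rw [Metric.mem_closedBall, dist_eq_norm] at hx
        simp only [coe_nnnorm] at hx
        linarith
      calc ‖a t x‖ ≤ ‖a t‖ * ‖x‖ := (a t).le_opNorm x
        _ ≤ 1 / 2 * (2 * ‖e₀‖) := by gcongr; exact hb t ht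
        _ = _ := by simp
    · simp
  exact h.exists_eq_forall_mem_Icc_hasDerivWithinAt₀

/-- Local solvability of `df = θ f` for a one-form `θ` with values in the endomorphisms of a
Banach space such that `dθ = θ ∧ θ`. -/
theorem exists_parallel_section [CompleteSpace E] {θ : V → V →L[ℝ] E →L[ℝ] E} {c : V}
    (hθ : ContDiffAt ℝ 2 θ c)
    (hflat : ∀ᶠ z in 𝓝 c, ∀ (u v : V) (e : E),
      fderiv ℝ θ z u v e - fderiv ℝ θ z v u e = θ z u (θ z v e) - θ z v (θ z u e)) :
    ∃ r : ℝ, 0 < r ∧ ∀ e₀ : E, ∃ f : V → E, f c = e₀ ∧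
      ∀ z ∈ Metric.ball c r, HasFDerivAt f ((θ z).flip (f z)) z := by
  obtain ⟨K, hK, r₁, hr₁, hdiff, htay⟩ := exists_taylor_bounds hθ
  obtain ⟨r₂, hr₂, hfl⟩ := Metric.eventually_nhds_iff_ball.1 hflat
  -- The condition `K * r ≤ 1 / 2` makes the coefficient of the radial equation small enough for
  -- `exists_linear_ode_solution`.
  obtain ⟨r, hr, hrr₁, hrr₂, hrK⟩ : ∃ r : ℝ, 0 < r ∧ r ≤ r₁ ∧ r ≤ r₂ ∧ K * r ≤ 1 / 2 := by
    refine ⟨min (min r₁ r₂) (1 / 2 / K), by positivity, ?_, ?_, ?_⟩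
    · exact (min_le_left _ _).trans (min_le_left _ _)
    · exact (min_le_left _ _).trans (min_le_right _ _)
    · calc K * _ ≤ K * (1 / 2 / K) := by gcongr; exact min_le_right _ _
        _ = _ := by field_simp
  have hsub₁ := Metric.ball_subset_ball (x := c) hrr₁
  have hsub₂ := Metric.ball_subset_ball (x := c) hrr₂
  refine ⟨r, hr, fun e₀ => ?_⟩
  have hseg : ∀ z ∈ Metric.ball c r, ∀ t ∈ Icc (0 : ℝ) 1, c + t • (z - c) ∈ Metric.ball c r :=
    fun z hz t ht => (convex_ball c r).add_smul_sub_mem (Metric.mem_ball_self hr) hz ht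
  have hcoef : ∀ z ∈ Metric.ball c r, ∀ t ∈ Icc (0 : ℝ) 1,
      ‖θ (c + t • (z - c)) (z - c)‖ ≤ 1 / 2 := fun z hz t ht => by
    have h1 := (hdiff _ (hsub₁ (hseg z hz t ht))).2
    have h2 : ‖z - c‖ ≤ r := by rw [← dist_eq_norm]; exact (Metric.mem_ball.1 hz).le
    calc _ ≤ ‖θ (c + t • (z - c))‖ * ‖z - c‖ := ContinuousLinearMap.le_opNorm _ _
      _ ≤ K * r := by gcongr
      _ ≤ _ := hrK
  have hsol : ∀ z : V, ∃ ψ : ℝ → E, z ∈ Metric.ball c r → ψ 0 = e₀ ∧ ∀ t ∈ Icc (0 : ℝ) 1,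
      HasDerivWithinAt ψ (θ (c + t • (z - c)) (z - c) (ψ t)) (Icc 0 1) t := fun z => by
    by_cases hz : z ∈ Metric.ball c r
    · obtain ⟨ψ, hψ⟩ := exists_linear_ode_solution
        (a := fun t => θ (c + t • (z - c)) (z - c))
        (fun t ht => (hasDerivAt_comp_line_apply (hdiff _ (hsub₁ (hseg z hz t ht))).1
          (z - c)).continuousAt.continuousWithinAt)
        (hcoef z hz) e₀
      exact ⟨ψ, fun _ => hψ⟩
    · exact ⟨0, fun h => absurd h hz⟩
  choose ψ hψ using hsol
  -- The solution at `z` is found by integrating the system along the segment from `c` to `z`.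
  refine ⟨fun z => ψ z 1, ?_, fun z hz => ?_⟩
  · obtain ⟨h0, h1⟩ := hψ c (Metric.mem_ball_self hr)
    have : ∀ t ∈ Icc (0 : ℝ) 1, ψ c t = ψ c 0 := by
      refine constant_of_has_deriv_right_zero (fun t ht => (h1 t ht).continuousWithinAt)
        (fun t ht => ?_)
      have := h1 t ⟨ht.1, ht.2.le⟩
      simp only [sub_self, map_zero, _root_.zero_apply] at this
      exact this.mono_of_mem_nhdsWithin (Icc_mem_nhdsGE_of_mem ht)
    exact (this 1 (by simp)).trans h0
  obtain ⟨hz0, hz1⟩ := hψ z hz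
  set u := z - c with hu
  have hur : ‖u‖ ≤ r := by rw [hu, ← dist_eq_norm]; exact (Metric.mem_ball.1 hz).le
  obtain ⟨M, hM⟩ := isCompact_Icc.exists_bound_of_continuousOn
    (f := ψ z) (fun t ht => (hz1 t ht).continuousWithinAt)
  set C : ℝ := K * r * M + K * M + (K * r + K) * K * M with hC
  have key : ∀ w : V, z + w ∈ Metric.ball c r →
      ‖ψ (z + w) 1 - ψ z 1 - θ z w (ψ z 1)‖ ≤ gronwallBound 0 1 C 1 * ‖w‖ ^ 2 := by
    intro w hw
    obtain ⟨hw0, hw1⟩ := hψ (z + w) hw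
    have hzw : z + w - c = u + w := by rw [hu]; abel
    rw [hzw] at hw1
    -- The term `t • θ (c + t • u) w (ψ z t)` is the expected variation of the radial solution in
    -- direction `w`; at `t = 1` the difference `D` is exactly the first-order Taylor error.
    -- Grönwall's inequality shows that it is quadratic in `w`.
    set D : ℝ → E := fun t => ψ (z + w) t - ψ z t - t • θ (c + t • u) w (ψ z t) with hD
    set D' : ℝ → E := fun t => θ (c + t • (u + w)) (u + w) (ψ (z + w) t)
      - θ (c + t • u) u (ψ z t) - (t • (fderiv ℝ θ (c + t • u) u w (ψ z t)
        + θ (c + t • u) w (θ (c + t • u) u (ψ z t))) + (1 : ℝ) • θ (c + t • u) w (ψ z t)) with hD'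
    have hder : ∀ t ∈ Icc (0 : ℝ) 1, HasDerivWithinAt D (D' t) (Icc 0 1) t := by
      intro t ht
      refine ((hw1 t ht).sub (hz1 t ht)).sub ?_
      exact hasDerivWithinAt_smul_clm_apply
        (hasDerivAt_comp_line_apply (hdiff _ (hsub₁ (hseg z hz t ht))).1 w) (hz1 t ht)
    have hbound : ∀ t ∈ Ico (0 : ℝ) 1, ‖D' t‖ ≤ 1 * ‖D t‖ + C * ‖w‖ ^ 2 := by
      intro t ht'
      have ht : t ∈ Icc (0 : ℝ) 1 := ⟨ht'.1, ht'.2.le⟩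
      have hp := hseg z hz t ht
      have hq := hseg (z + w) hw t ht
      rw [hzw] at hq
      rw [← hu] at hp
      set p := c + t • u with hp_def
      set q := c + t • (u + w) with hq_def
      have hqp : q - p = t • w := by rw [hp_def, hq_def]; module
      obtain ⟨hl, hT⟩ := htay p (hsub₁ hp) q (hsub₁ hq)
      have htw : ‖t • w‖ ≤ ‖w‖ := by
        rw [norm_smul, Real.norm_of_nonneg ht.1]
        exact mul_le_of_le_one_left (norm_nonneg _) ht.2
      rw [hqp] at hl hT
      replace hl : ‖θ q - θ p‖ ≤ K * ‖w‖ := hl.trans (by gcongr)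
      replace hT : ‖θ q - θ p - fderiv ℝ θ p (t • w)‖ ≤ K * ‖w‖ ^ 2 := hT.trans (by gcongr)
      have hfp := hfl p (hsub₂ hp) u w (ψ z t)
      -- Flatness exchanges `u` and `w` in the derivative of `θ`. The first-order terms then cancel,
      -- leaving a linear term in `D` and an error of order `‖w‖ ^ 2`.
      have hsplit : D' t = θ q (u + w) (D t) + ((θ q - θ p - fderiv ℝ θ p (t • w)) u (ψ z t)
          + (θ q - θ p) w (ψ z t)
          + t • ((θ q - θ p) u (θ p w (ψ z t)) + θ q w (θ p w (ψ z t)))) := by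
        have : fderiv ℝ θ p u w (ψ z t) = fderiv ℝ θ p w u (ψ z t)
          + (θ p u (θ p w (ψ z t)) - θ p w (θ p u (ψ z t))) := by rw [← hfp]; abel
        simp only [hD', hD, ← hp_def, ← hq_def]
        rw [this]
        simp only [map_add, map_sub, map_smul, _root_.add_apply,
          _root_.sub_apply, _root_.smul_apply]
        module
      have hθp := (hdiff p (hsub₁ hp)).2
      have hθq := (hdiff q (hsub₁ hq)).2
      have hψt := hM t ht
      have hco : ‖θ q (u + w)‖ ≤ 1 / 2 := by
        have := hcoef (z + w) hw t ht
        rwa [hzw] at this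
      have bd : ∀ (T : V →L[ℝ] E →L[ℝ] E) (x : V) (e : E) (α β γ : ℝ), ‖T‖ ≤ α → ‖x‖ ≤ β →
          ‖e‖ ≤ γ → ‖T x e‖ ≤ α * β * γ := fun T x e α β γ h1 h2 h3 =>
        (T x).le_of_opNorm_le_of_le (T.le_of_opNorm_le_of_le h1 h2) h3
      have b0 := bd _ _ _ _ _ _ hθp (le_refl ‖w‖) hψt
      have b1 := bd _ _ _ _ _ _ hT hur hψt
      have b2 := bd _ _ _ _ _ _ hl (le_refl ‖w‖) hψt
      have b3 := bd _ _ _ _ _ _ hl hur b0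
      have b4 := bd _ _ _ _ _ _ hθq (le_refl ‖w‖) b0
      have b5 : ‖t • ((θ q - θ p) u (θ p w (ψ z t)) + θ q w (θ p w (ψ z t)))‖ ≤
          K * ‖w‖ * r * (K * ‖w‖ * M) + K * ‖w‖ * (K * ‖w‖ * M) := by
        rw [norm_smul, Real.norm_of_nonneg ht.1]
        exact (mul_le_of_le_one_left (norm_nonneg _) ht.2).trans (norm_add_le_of_le b3 b4)
      have b6 : ‖θ q (u + w) (D t)‖ ≤ 1 * ‖D t‖ :=
        (ContinuousLinearMap.le_of_opNorm_le _ (hco.trans (by norm_num)) _)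
      rw [hsplit]
      refine (norm_add_le_of_le b6 (norm_add_le_of_le (norm_add_le_of_le b1 b2) b5)).trans
        (le_of_eq ?_)
      rw [hC]
      ring
    have hgr := norm_le_gronwallBound_of_norm_deriv_right_le (δ := 0) (K := 1)
      (ε := C * ‖w‖ ^ 2)
      (fun t ht => (hder t ht).continuousWithinAt)
      (fun t ht => (hder t ⟨ht.1, ht.2.le⟩).mono_of_mem_nhdsWithin (Icc_mem_nhdsGE_of_mem ht))
      (by simp [hD, hw0, hz0]) hbound 1 (by simp)
    have hc1 : c + u = z := by rw [hu]; module
    simp only [hD, one_smul, hc1] at hgr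
    refine hgr.trans (le_of_eq ?_)
    simp only [gronwallBound_of_K_ne_0 one_ne_zero]
    ring_nf
  rw [hasFDerivAt_iff_isLittleO_nhds_zero]
  have hO : (fun w => ψ (z + w) 1 - ψ z 1 - (θ z).flip (ψ z 1) w) =O[𝓝 0]
      fun w : V => ‖w‖ ^ 2 := by
    refine Asymptotics.IsBigO.of_bound (gronwallBound 0 1 C 1) ?_
    have : ∀ᶠ w in 𝓝 (0 : V), z + w ∈ Metric.ball c r :=
      (continuous_const.add continuous_id).continuousAt.eventually_mem
        (Metric.isOpen_ball.mem_nhds (by simpa using hz))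
    filter_upwards [this] with w hw
    simpa using key w hw
  exact hO.trans_isLittleO ((Asymptotics.isLittleO_norm_pow_id one_lt_two))

end FlatSections

/-! ### Entrywise differential calculus for scalar and matrix valued functions on the surface. -/

section Calculus

variable {X : Type*} [TopologicalSpace X] [ChartedSpace ℂ X]

/-- A Riemann surface is a smooth real manifold. -/
theorem isManifold_real [IsManifold 𝓘(ℂ, ℂ) ω X] : IsManifold 𝓘(ℝ, ℂ) ∞ X := by
  refine isManifold_of_contDiffOn _ _ _ fun e e' he he' => ?_
  have h := (mem_groupoid_of_pregroupoid.1
    (HasGroupoid.compatible (G := contDiffGroupoid ω 𝓘(ℂ, ℂ)) he he')).1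
  simp only [contDiffPregroupoid] at h
  simpa using (h.restrict_scalars ℝ).of_le (m := ∞) le_top

/-- The complex valued function `f` is smooth at `p`. -/
abbrev SmoothAt (f : X → ℂ) (p : X) : Prop := ContMDiffAt 𝓘(ℝ, ℂ) 𝓘(ℝ, ℂ) ∞ f p

/-- The derivative `df(v)` at `p` of a complex valued function `f`. -/
def dFun (f : X → ℂ) (p : X) (v : TangentSpace 𝓘(ℝ, ℂ) p) : ℂ :=
  mfderiv 𝓘(ℝ, ℂ) 𝓘(ℝ, ℂ) f p v

/-- The matrix valued function `F` is smooth at `p`. -/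
def SmoothMatAt (F : X → Mat) (p : X) : Prop := ∀ i j : Fin 2, SmoothAt (fun q => F q i j) p

variable {f g : X → ℂ} {F G : X → Mat} {p : X} {v : TangentSpace 𝓘(ℝ, ℂ) p}

theorem SmoothAt.mdiff (hf : SmoothAt f p) : MDifferentiableAt 𝓘(ℝ, ℂ) 𝓘(ℝ, ℂ) f p :=
  ContMDiffAt.mdifferentiableAt hf (by simp)

theorem SmoothAt.add (hf : SmoothAt f p) (hg : SmoothAt g p) :
    SmoothAt (fun q => f q + g q) p := ContMDiffAt.add hf hg

theorem SmoothAt.sub (hf : SmoothAt f p) (hg : SmoothAt g p) :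
    SmoothAt (fun q => f q - g q) p := ContMDiffAt.sub hf hg

theorem SmoothAt.neg (hf : SmoothAt f p) : SmoothAt (fun q => - f q) p := ContMDiffAt.neg hf

theorem SmoothAt.mul (hf : SmoothAt f p) (hg : SmoothAt g p) :
    SmoothAt (fun q => f q * g q) p :=
  ((contDiff_mul (𝕜 := ℝ) (𝔸 := ℂ)).contMDiff.contMDiffAt (x := (f p, g p))).comp p
    (ContMDiffAt.prodMk_space hf hg)

theorem SmoothAt.conj (hf : SmoothAt f p) : SmoothAt (fun q => conj (f q)) p :=
  (Complex.conjCLE.contDiff.contMDiff.contMDiffAt (x := f p)).comp p hf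

theorem smoothAt_const (c : ℂ) : SmoothAt (fun _ : X => c) p := contMDiffAt_const

theorem dFun_add (hf : SmoothAt f p) (hg : SmoothAt g p) :
    dFun (fun q => f q + g q) p v = dFun f p v + dFun g p v :=
  congrArg (· v) (hf.mdiff.hasMFDerivAt.add hg.mdiff.hasMFDerivAt).mfderiv

theorem dFun_sub (hf : SmoothAt f p) (hg : SmoothAt g p) :
    dFun (fun q => f q - g q) p v = dFun f p v - dFun g p v :=
  congrArg (· v) (hf.mdiff.hasMFDerivAt.sub hg.mdiff.hasMFDerivAt).mfderiv

theorem dFun_neg (hf : SmoothAt f p) : dFun (fun q => - f q) p v = - dFun f p v :=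
  congrArg (· v) hf.mdiff.hasMFDerivAt.neg.mfderiv

theorem dFun_mul (hf : SmoothAt f p) (hg : SmoothAt g p) :
    dFun (fun q => f q * g q) p v = dFun f p v * g p + f p * dFun g p v := by
  have h := congrArg (· v) (HasMFDerivAt.mul hf.mdiff.hasMFDerivAt hg.mdiff.hasMFDerivAt).mfderiv
  refine h.trans ?_
  change f p * dFun g p v + g p * dFun f p v = _
  ring

theorem dFun_const (c : ℂ) : dFun (fun _ : X => c) p v = 0 :=
  congrArg (· v) (hasMFDerivAt_const (I := 𝓘(ℝ, ℂ)) (I' := 𝓘(ℝ, ℂ)) c p).mfderiv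

theorem dFun_conj (hf : SmoothAt f p) :
    dFun (fun q => conj (f q)) p v = conj (dFun f p v) :=
  congrArg (· v) ((Complex.conjCLE.toContinuousLinearMap.hasMFDerivAt).comp p
    hf.mdiff.hasMFDerivAt).mfderiv

theorem dFun_congr (h : f =ᶠ[𝓝 p] g) : dFun f p v = dFun g p v := by
  exact congrArg (fun L : ℂ →L[ℝ] ℂ => L v) (h.mfderiv_eq (I := 𝓘(ℝ, ℂ)) (I' := 𝓘(ℝ, ℂ)))

theorem dMat_apply (i j : Fin 2) : dMat F p v i j = dFun (fun q => F q i j) p v := rfl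

theorem SmoothMatAt.mul (hF : SmoothMatAt F p) (hG : SmoothMatAt G p) :
    SmoothMatAt (fun q => F q * G q) p := fun i j => by
  simp only [Matrix.mul_apply, Fin.sum_univ_two]
  exact ((hF i 0).mul (hG 0 j)).add ((hF i 1).mul (hG 1 j))

theorem SmoothMatAt.sub (hF : SmoothMatAt F p) (hG : SmoothMatAt G p) :
    SmoothMatAt (fun q => F q - G q) p := fun i j => (hF i j).sub (hG i j)

theorem SmoothMatAt.conjTranspose (hF : SmoothMatAt F p) : SmoothMatAt (fun q => (F q)ᴴ) p :=
  fun i j => (hF j i).conj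

theorem SmoothMatAt.adjugate (hF : SmoothMatAt F p) :
    SmoothMatAt (fun q => (F q).adjugate) p := fun i j => by
  simp only [Matrix.adjugate_fin_two]
  fin_cases i <;> fin_cases j <;> simp [hF _ _, (hF _ _).neg]

theorem smoothMatAt_const (C : Mat) : SmoothMatAt (fun _ : X => C) p :=
  fun i j => smoothAt_const (C i j)

theorem SmoothMatAt.det (hF : SmoothMatAt F p) : SmoothAt (fun q => (F q).det) p := by
  simp only [Matrix.det_fin_two]
  exact ((hF 0 0).mul (hF 1 1)).sub ((hF 0 1).mul (hF 1 0))

theorem dMat_mul (hF : SmoothMatAt F p) (hG : SmoothMatAt G p) :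
    dMat (fun q => F q * G q) p v = dMat F p v * G p + F p * dMat G p v := by
  ext i j
  simp only [dMat_apply, Matrix.add_apply, Matrix.mul_apply, Fin.sum_univ_two]
  rw [dFun_add ((hF i 0).mul (hG 0 j)) ((hF i 1).mul (hG 1 j)), dFun_mul (hF i 0) (hG 0 j),
    dFun_mul (hF i 1) (hG 1 j)]
  ring

theorem dMat_sub (hF : SmoothMatAt F p) (hG : SmoothMatAt G p) :
    dMat (fun q => F q - G q) p v = dMat F p v - dMat G p v := by
  ext i j
  exact dFun_sub (hF i j) (hG i j)

theorem dMat_conjTranspose (hF : SmoothMatAt F p) :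
    dMat (fun q => (F q)ᴴ) p v = (dMat F p v)ᴴ := by
  ext i j
  exact dFun_conj (hF j i)

theorem dMat_const (C : Mat) : dMat (fun _ : X => C) p v = 0 := by
  ext i j
  exact dFun_const (C i j)

theorem dMat_adjugate (hF : SmoothMatAt F p) :
    dMat (fun q => (F q).adjugate) p v = (dMat F p v).adjugate := by
  ext i j
  rw [dMat_apply]
  simp only [Matrix.adjugate_fin_two]
  fin_cases i <;> fin_cases j
  · rfl
  · exact dFun_neg (hF 0 1)
  · exact dFun_neg (hF 1 0)
  · rfl

theorem dMat_congr (h : F =ᶠ[𝓝 p] G) : dMat F p v = dMat G p v := by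
  ext i j
  exact dFun_congr (h.mono fun q hq => by simp only [hq])

theorem dFun_det (hF : SmoothMatAt F p) :
    dFun (fun q => (F q).det) p v = ((F p).adjugate * dMat F p v).trace := by
  simp only [Matrix.det_fin_two]
  rw [dFun_sub ((hF 0 0).mul (hF 1 1)) ((hF 0 1).mul (hF 1 0)), dFun_mul (hF 0 0) (hF 1 1),
    dFun_mul (hF 0 1) (hF 1 0)]
  simp only [Matrix.trace_fin_two, Matrix.mul_apply, Matrix.adjugate_fin_two, Fin.sum_univ_two,
    dMat_apply, Matrix.of_apply, Matrix.cons_val_zero, Matrix.cons_val_one, Matrix.cons_val']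
  ring

theorem dSec_apply {s : X → Fib} (hs : ContMDiffAt 𝓘(ℝ, ℂ) 𝓘(ℝ, Fib) ∞ s p) (i : Fin 2) :
    dSec s p v i = dFun (fun q => s q i) p v :=
  (congrArg (· v) (((ContinuousLinearMap.proj (R := ℝ) (φ := fun _ : Fin 2 => ℂ) i).hasMFDerivAt).comp
    p (hs.mdifferentiableAt (by simp)).hasMFDerivAt).mfderiv).symm

theorem smoothAt_apply {s : X → Fib} (hs : ContMDiffAt 𝓘(ℝ, ℂ) 𝓘(ℝ, Fib) ∞ s p) (i : Fin 2) :
    SmoothAt (fun q => s q i) p := contMDiffAt_pi_space.1 hs i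

/-- A function whose derivative vanishes near `p` is constant near `p`. -/
theorem eventually_eq_of_dFun_eq_zero [IsManifold 𝓘(ℝ, ℂ) ∞ X]
    (h : ∀ᶠ q in 𝓝 p, SmoothAt f q ∧ ∀ v : TangentSpace 𝓘(ℝ, ℂ) q, dFun f q v = 0) :
    ∀ᶠ q in 𝓝 p, f q = f p := by
  set e := chartAt ℂ p
  have hp : p ∈ e.source := mem_chart_source ℂ p
  have hz : e p ∈ e.target := e.map_source hp
  have h1 : ∀ᶠ z in 𝓝 (e p), SmoothAt f (e.symm z) ∧
      ∀ v : TangentSpace 𝓘(ℝ, ℂ) (e.symm z), dFun f (e.symm z) v = 0 := by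
    have h2 := e.continuousAt_symm hz
    rw [ContinuousAt, e.left_inv hp] at h2
    exact h2.eventually h
  obtain ⟨r, hr, hball⟩ := Metric.eventually_nhds_iff_ball.1
    (h1.and (e.open_target.mem_nhds hz))
  have hd : ∀ z ∈ Metric.ball (e p) r, HasFDerivAt (f ∘ e.symm) (0 : ℂ →L[ℝ] ℂ) z := by
    intro z hzr
    obtain ⟨⟨hs, h0⟩, ht⟩ := hball z hzr
    have h2 := (mdifferentiableAt_atlas_symm (I := 𝓘(ℝ, ℂ)) (chart_mem_atlas ℂ p) ht).hasMFDerivAt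
    have h3 := (hs.mdiff.hasMFDerivAt.comp z h2).hasFDerivAt
    exact h3.congr_fderiv (ContinuousLinearMap.ext fun v => h0 _)
  have hc : ∀ z ∈ Metric.ball (e p) r, (f ∘ e.symm) z = (f ∘ e.symm) (e p) := fun z hzr =>
    Metric.isOpen_ball.is_const_of_fderiv_eq_zero (𝕜 := ℝ) (convex_ball _ _).isPreconnected
      (fun w hw => (hd w hw).differentiableAt.differentiableWithinAt)
      (fun w hw => (hd w hw).fderiv) hzr (Metric.mem_ball_self hr)
  filter_upwards [e.open_source.mem_nhds hp,
    (e.continuousAt hp).eventually_mem (Metric.ball_mem_nhds _ hr)] with q hq hqr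
  have := hc _ hqr
  rwa [Function.comp_apply, Function.comp_apply, e.left_inv hq, e.left_inv hp] at this

/-- A smooth function with vanishing derivative is constant on a connected surface. -/
theorem eq_of_dFun_eq_zero [IsManifold 𝓘(ℝ, ℂ) ∞ X] [PreconnectedSpace X]
    (hf : ∀ q, SmoothAt f q) (h : ∀ q (v : TangentSpace 𝓘(ℝ, ℂ) q), dFun f q v = 0) (p q : X) :
    f p = f q :=
  ((IsLocallyConstant.iff_eventually_eq f).2 fun _ =>
    eventually_eq_of_dFun_eq_zero (Eventually.of_forall fun q => ⟨hf q, h q⟩)).apply_eq_of_preconnectedSpace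
    p q

/-- A matrix valued function whose derivative vanishes near `p` is constant near `p`. -/
theorem eventually_eq_of_dMat_eq_zero [IsManifold 𝓘(ℝ, ℂ) ∞ X]
    (h : ∀ᶠ q in 𝓝 p, SmoothMatAt F q ∧ ∀ v : TangentSpace 𝓘(ℝ, ℂ) q, dMat F q v = 0) :
    ∀ᶠ q in 𝓝 p, F q = F p := by
  have h1 : ∀ i j, ∀ᶠ q in 𝓝 p, F q i j = F p i j := fun i j =>
    eventually_eq_of_dFun_eq_zero (f := fun q => F q i j) (h.mono fun q hq =>
      ⟨hq.1 i j, fun v => by rw [← dMat_apply, hq.2 v]; rfl⟩)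
  filter_upwards [eventually_all.2 fun i => eventually_all.2 (h1 i)] with q hq
  exact Matrix.ext hq

end Calculus

/-! ### Parallel frames of a flat connection and transport along chart segments. -/

section Frames

/-- Solutions of `df = θ f` with smooth `θ` are smooth. -/
theorem contDiffOn_of_hasFDerivAt_flip {V E : Type*} [NormedAddCommGroup V] [NormedSpace ℝ V]
    [NormedAddCommGroup E] [NormedSpace ℝ E] {θ : V → V →L[ℝ] E →L[ℝ] E} {s : Set V}
    (hs : IsOpen s) (hθ : ContDiffOn ℝ ∞ θ s) {f : V → E}
    (hf : ∀ z ∈ s, HasFDerivAt f ((θ z).flip (f z)) z) : ContDiffOn ℝ ∞ f s := by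
  -- Bootstrap: if `f` is `C^n`, the equation makes its derivative `C^n`, hence `f` is `C^(n+1)`.
  refine contDiffOn_infty.2 fun n => ?_
  induction n with
  | zero =>
    exact contDiffOn_zero.2 fun z hz => (hf z hz).continuousAt.continuousWithinAt
  | succ n ih =>
    rw [Nat.cast_succ, contDiffOn_succ_iff_fderiv_of_isOpen hs]
    refine ⟨fun z hz => (hf z hz).differentiableAt.differentiableWithinAt, by simp, ?_⟩
    have h0 : ContDiff ℝ n (fun L : V →L[ℝ] E →L[ℝ] E => L.flip) :=
      (IsLinearMap.with_bound ⟨fun _ _ => rfl, fun _ _ => rfl⟩ 1 fun L => by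
        rw [ContinuousLinearMap.opNorm_flip, one_mul]).contDiff
    have h1 : ContDiffOn ℝ n (fun z => (θ z).flip) s :=
      h0.comp_contDiffOn (contDiffOn_infty.1 hθ n)
    exact (h1.clm_apply ih).congr fun z hz => (hf z hz).fderiv

theorem hasFDerivAt_clm_apply_const {V U F : Type*} [NormedAddCommGroup V] [NormedSpace ℝ V]
    [NormedAddCommGroup U] [NormedSpace ℝ U] [NormedAddCommGroup F] [NormedSpace ℝ F]
    {θ : V → U →L[ℝ] F} {θ' : V →L[ℝ] U →L[ℝ] F} {z : V} (h : HasFDerivAt θ θ' z) (u : U) :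
    HasFDerivAt (fun w => θ w u) (θ'.flip u) z :=
  ((ContinuousLinearMap.apply ℝ F u).hasFDerivAt.comp z h).congr_fderiv
    (ContinuousLinearMap.ext fun _ => rfl)

variable {X : Type*} [TopologicalSpace X] [ChartedSpace ℂ X]

theorem inChart_add (A : MatForm X) (x₀ : X) (z u v : ℂ) :
    inChart A x₀ z (u + v) = inChart A x₀ z u + inChart A x₀ z v := by
  unfold inChart
  exact (congrArg _ (map_add _ u v)).trans (map_add _ _ _)

theorem inChart_smul (A : MatForm X) (x₀ : X) (z : ℂ) (a : ℝ) (v : ℂ) :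
    inChart A x₀ z (a • v) = a • inChart A x₀ z v := by
  unfold inChart
  exact (congrArg _ (map_smul _ a v)).trans (map_smul _ _ _)

/-- The coefficient form of the equation `dg = g A` for row vectors `g`, in a chart. -/
def rowForm (A : MatForm X) (x₀ : X) (z : ℂ) : ℂ →L[ℝ] Fib →L[ℝ] Fib :=
  LinearMap.toContinuousLinearMap
    { toFun := fun v => LinearMap.toContinuousLinearMap
        ((Matrix.vecMulLinear (inChart A x₀ z v)).restrictScalars ℝ)
      map_add' := fun u v => by
        ext1 g
        exact (congrArg (g ᵥ* ·) (inChart_add A x₀ z u v)).trans (Matrix.vecMul_add _ _ _)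
      map_smul' := fun a v => by
        ext1 g
        exact (congrArg (g ᵥ* ·) (inChart_smul A x₀ z a v)).trans (Matrix.vecMul_smul _ _ _) }

theorem rowForm_apply (A : MatForm X) (x₀ : X) (z v : ℂ) (g : Fib) :
    rowForm A x₀ z v g = g ᵥ* inChart A x₀ z v := rfl

theorem rowForm_apply_apply (A : MatForm X) (x₀ : X) (z v : ℂ) (g : Fib) (j : Fin 2) :
    rowForm A x₀ z v g j = g 0 * inChart A x₀ z v 0 j + g 1 * inChart A x₀ z v 1 j := by
  rw [rowForm_apply, Matrix.vecMul, dotProduct, Fin.sum_univ_two]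

theorem contDiffOn_rowForm {A : MatForm X} (hA : IsSmoothForm A) (x₀ : X) :
    ContDiffOn ℝ ∞ (rowForm A x₀) (chartAt ℂ x₀).target := by
  refine contDiffOn_clm_apply.2 fun v => contDiffOn_clm_apply.2 fun g => contDiffOn_pi.2 fun j => ?_
  simp only [rowForm_apply_apply]
  exact (contDiffOn_const.mul (hA x₀ v 0 j)).add (contDiffOn_const.mul (hA x₀ v 1 j))

/-- Row vectors are multiplied from the right, which reverses the order of products. Thus `dA + A ∧
A = 0` becomes `dθ = θ ∧ θ`, the integrability condition of `exists_parallel_section`. -/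
theorem rowForm_flat {A : MatForm X} (hA : IsSmoothForm A) (hflat : IsFlat A) (x₀ : X) {z : ℂ}
    (hz : z ∈ (chartAt ℂ x₀).target) (u v : ℂ) (g : Fib) :
    fderiv ℝ (rowForm A x₀) z u v g - fderiv ℝ (rowForm A x₀) z v u g =
      rowForm A x₀ z u (rowForm A x₀ z v g) - rowForm A x₀ z v (rowForm A x₀ z u g) := by
  have hopen := (chartAt ℂ x₀).open_target
  have hdA : ∀ v i j, DifferentiableAt ℝ (fun z => inChart A x₀ z v i j) z := fun v i j =>
    ((hA x₀ v i j).contDiffAt (hopen.mem_nhds hz)).differentiableAt (by simp)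
  have hd : DifferentiableAt ℝ (rowForm A x₀) z :=
    ((contDiffOn_rowForm hA x₀).contDiffAt (hopen.mem_nhds hz)).differentiableAt (by simp)
  have key : ∀ (u v : ℂ) (j : Fin 2), fderiv ℝ (rowForm A x₀) z u v g j =
      g 0 * fderiv ℝ (fun z => inChart A x₀ z v 0 j) z u
        + g 1 * fderiv ℝ (fun z => inChart A x₀ z v 1 j) z u := by
    intro u v j
    have h1 := hasFDerivAt_pi'.1 (hasFDerivAt_clm_apply_const
      (hasFDerivAt_clm_apply_const hd.hasFDerivAt v) g) j
    simp only [rowForm_apply_apply] at h1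
    have h2 := ((hdA v 0 j).hasFDerivAt.const_mul (g 0)).add
      ((hdA v 1 j).hasFDerivAt.const_mul (g 1))
    exact congrArg (fun L : ℂ →L[ℝ] ℂ => L u) (h1.unique h2)
  ext j
  have h0 := hflat x₀ z hz u v 0 j
  have h1 := hflat x₀ z hz u v 1 j
  simp only [Matrix.sub_apply, Matrix.mul_apply, Fin.sum_univ_two] at h0 h1
  simp only [Pi.sub_apply, key, rowForm_apply_apply]
  linear_combination g 0 * h0 + g 1 * h1

theorem inChart_mfderiv [IsManifold 𝓘(ℝ, ℂ) ∞ X] (A : MatForm X) {x₀ q : X}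
    (hq : q ∈ (chartAt ℂ x₀).source) (v : TangentSpace 𝓘(ℝ, ℂ) q) :
    inChart A x₀ (chartAt ℂ x₀ q) (mfderiv 𝓘(ℝ, ℂ) 𝓘(ℝ, ℂ) (chartAt ℂ x₀) q v) = A q v := by
  have h := (mdifferentiable_chart (I := 𝓘(ℝ, ℂ)) x₀).symm_comp_deriv hq
  -- The tangent space depends on the point, so the equalities of points and of vectors have to be
  -- substituted together.
  have h1 : ∀ (q' : X) (w : ℂ), q' = q → w = v → A q' w = A q v := by
    rintro _ _ rfl rfl
    rfl
  exact h1 _ _ ((chartAt ℂ x₀).left_inv hq) (congrArg (fun L : ℂ →L[ℝ] ℂ => L v) h)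

theorem adjugate_eq_neg {M : Mat} (h : M.trace = 0) : M.adjugate = - M := by
  rw [Matrix.trace_fin_two] at h
  ext i j
  rw [Matrix.adjugate_fin_two]
  fin_cases i <;> fin_cases j <;> simp <;> linear_combination h

/-- A flat connection has a local frame of parallel sections; `G` is the inverse frame. -/
theorem exists_flat_frame [IsManifold 𝓘(ℝ, ℂ) ∞ X] {A : MatForm X} (hA : IsSmoothForm A)
    (htr : IsTraceFree A) (hflat : IsFlat A) (x₀ : X) :
    ∃ G : X → Mat, ∀ᶠ q in 𝓝 x₀, SmoothMatAt G q ∧ (G q).det = 1 ∧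
      ∀ v : TangentSpace 𝓘(ℝ, ℂ) q, dMat G q v = G q * A q v := by
  set e := chartAt ℂ x₀ with he
  have hx₀ : x₀ ∈ e.source := mem_chart_source ℂ x₀
  have hz₀ : e x₀ ∈ e.target := e.map_source hx₀
  have ht := e.open_target.mem_nhds hz₀
  have hθ := contDiffOn_rowForm hA x₀
  obtain ⟨r₁, hr₁, hsol⟩ := exists_parallel_section
    (contDiffAt_infty.1 (hθ.contDiffAt ht) 2)
    (by filter_upwards [ht] with z hz using rowForm_flat hA hflat x₀ hz)
  obtain ⟨r₂, hr₂, hball⟩ := Metric.mem_nhds_iff.1 ht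
  obtain ⟨r, hr, hrr₁, hrr₂⟩ : ∃ r, 0 < r ∧ r ≤ r₁ ∧ r ≤ r₂ :=
    ⟨min r₁ r₂, lt_min hr₁ hr₂, min_le_left _ _, min_le_right _ _⟩
  have ht' : Metric.ball (e x₀) r ⊆ e.target := (Metric.ball_subset_ball hrr₂).trans hball
  choose g hg₀ hg using fun i : Fin 2 => hsol (Pi.single i 1)
  have hg' : ∀ i, ∀ z ∈ Metric.ball (e x₀) r,
      HasFDerivAt (g i) ((rowForm A x₀ z).flip (g i z)) z := fun i z hz =>
    hg i z (Metric.ball_subset_ball hrr₁ hz)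
  have hgs : ∀ i, ContDiffOn ℝ ∞ (g i) (Metric.ball (e x₀) r) := fun i =>
    contDiffOn_of_hasFDerivAt_flip Metric.isOpen_ball (hθ.mono ht') (hg' i)
  -- The rows are the solutions of `dg = g A` that start at the standard basis vectors, so `G x₀ =
  -- 1`.
  set G : X → Mat := fun q => Matrix.of fun i => g i (e q) with hG
  have hev : ∀ᶠ q in 𝓝 x₀, SmoothMatAt G q ∧
      ∀ v : TangentSpace 𝓘(ℝ, ℂ) q, dMat G q v = G q * A q v := by
    filter_upwards [e.open_source.mem_nhds hx₀,
      (e.continuousAt hx₀).eventually_mem (Metric.ball_mem_nhds _ hr)] with q hq hqr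
    have hqb := Metric.isOpen_ball.mem_nhds hqr
    refine ⟨fun i j => ?_, fun v => ?_⟩
    · have h1 : ContDiffAt ℝ ∞ (fun z => g i z j) (e q) :=
        contDiffAt_pi.1 ((hgs i).contDiffAt hqb) j
      exact h1.contMDiffAt.comp q (contMDiffOn_chart.contMDiffAt (e.open_source.mem_nhds hq))
    · ext i j
      have h1 : HasFDerivAt (fun z => g i z j)
          ((ContinuousLinearMap.proj (R := ℝ) (φ := fun _ : Fin 2 => ℂ) j).comp
            ((rowForm A x₀ (e q)).flip (g i (e q)))) (e q) :=
        (ContinuousLinearMap.proj (R := ℝ) (φ := fun _ : Fin 2 => ℂ) j).hasFDerivAt.comp _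
          (hg' i _ hqr)
      have h2 := (mdifferentiableAt_atlas (I := 𝓘(ℝ, ℂ)) (chart_mem_atlas ℂ x₀) hq).hasMFDerivAt
      have h3 := (h1.hasMFDerivAt.comp q h2).mfderiv
      refine (congrArg (fun L : ℂ →L[ℝ] ℂ => L v) h3).trans ?_
      exact congrArg (fun M : Mat => (g i (e q) ᵥ* M) j) (inChart_mfderiv A hq v)
  -- Jacobi's formula: the derivative of `det G` is `det G` times the trace of `A`, which is zero.
  have hdet : ∀ᶠ q in 𝓝 x₀, (G q).det = (G x₀).det := by
    refine eventually_eq_of_dFun_eq_zero (f := fun q => (G q).det) (hev.mono fun q hq =>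
      ⟨hq.1.det, fun v => ?_⟩)
    rw [dFun_det hq.1, hq.2, ← mul_assoc, Matrix.adjugate_mul, Matrix.smul_mul, one_mul,
      Matrix.trace_smul, htr, smul_zero]
  refine ⟨G, ?_⟩
  filter_upwards [hev, hdet] with q hq hq'
  refine ⟨hq.1, hq'.trans ?_, hq.2⟩
  simp [hG, Matrix.det_fin_two, hg₀]

/-- Where `det G = 1` the adjugate is `G⁻¹`, and the equation says that its columns are parallel
sections. -/
theorem dMat_adjugate_frame {A : MatForm X} (htr : IsTraceFree A) {G : X → Mat} {q : X}
    (hG : SmoothMatAt G q) {v : TangentSpace 𝓘(ℝ, ℂ) q} (hd : dMat G q v = G q * A q v) :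
    dMat (fun q => (G q).adjugate) q v = - A q v * (G q).adjugate := by
  rw [dMat_adjugate hG, hd, Matrix.adjugate_mul_distrib, adjugate_eq_neg (htr q v)]

/-- In a small chart ball, transport along segments is given by a parallel frame. -/
theorem exists_frame_transport [IsManifold 𝓘(ℝ, ℂ) ∞ X] {A : MatForm X} (hA : IsSmoothForm A)
    (htr : IsTraceFree A) (hflat : IsFlat A) (x₀ : X) :
    ∃ G : X → Mat, ∃ W ∈ 𝓝 x₀, (∀ q ∈ W, SmoothMatAt G q ∧ (G q).det = 1 ∧
      ∀ v : TangentSpace 𝓘(ℝ, ℂ) q, dMat G q v = G q * A q v) ∧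
      ∀ q ∈ W, ∀ q' ∈ W, IsTransport A q q' ((G q').adjugate * G q) := by
  obtain ⟨G, hG⟩ := exists_flat_frame hA htr hflat x₀
  set e := chartAt ℂ x₀ with he
  have hx₀ : x₀ ∈ e.source := mem_chart_source ℂ x₀
  have hz₀ : e x₀ ∈ e.target := e.map_source hx₀
  have hG' := hG
  rw [← e.left_inv hx₀] at hG'
  obtain ⟨r, hr, hball⟩ := Metric.eventually_nhds_iff_ball.1
    (((e.continuousAt_symm hz₀).eventually hG').and (e.open_target.mem_nhds hz₀))
  set W := e.source ∩ e ⁻¹' Metric.ball (e x₀) r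
  have hW : ∀ q ∈ W, SmoothMatAt G q ∧ (G q).det = 1 ∧
      ∀ v : TangentSpace 𝓘(ℝ, ℂ) q, dMat G q v = G q * A q v := fun q hq => by
    have := (hball _ hq.2).1
    rwa [e.left_inv hq.1] at this
  refine ⟨G, W, inter_mem (e.open_source.mem_nhds hx₀)
    ((e.continuousAt hx₀).eventually_mem (Metric.ball_mem_nhds _ hr)), hW, fun q hq q' hq' => ?_⟩
  set l : ℝ → ℂ := fun t => e q + t • (e q' - e q) with hl
  have hlmem : ∀ t ∈ Icc (0 : ℝ) 1, l t ∈ Metric.ball (e x₀) r := fun t ht =>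
    (convex_ball _ r).add_smul_sub_mem hq.2 hq'.2 ht
  have hls : ContDiff ℝ 1 l := contDiff_const.add (contDiff_id.smul contDiff_const)
  set γ : ℝ → X := fun t => e.symm (l t) with hγ
  have hγW : ∀ t ∈ Icc (0 : ℝ) 1, γ t ∈ W := fun t ht =>
    ⟨e.map_target (hball _ (hlmem t ht)).2, by
      simpa [hγ, e.right_inv (hball _ (hlmem t ht)).2] using hlmem t ht⟩
  have hγs : ContMDiffOn 𝓘(ℝ, ℝ) 𝓘(ℝ, ℂ) 1 γ (Icc 0 1) :=
    ((contMDiffOn_chart_symm (I := 𝓘(ℝ, ℂ)) (n := ∞) (x := x₀)).of_le (by simp)).comp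
      hls.contMDiff.contMDiffOn fun t ht => (hball _ (hlmem t ht)).2
  set ψ : ℝ → Mat := fun t => (G (γ t)).adjugate * G q with hψ
  have hγ0 : γ 0 = q := by simp [hγ, hl, e.left_inv hq.1]
  have hγ1 : γ 1 = q' := by simp [hγ, hl, e.left_inv hq'.1]
  have h := IsTransport.path (A := A) γ ψ hγs ?_ ?_
  · rw [hγ0, hγ1] at h
    simpa only [hψ, hγ1] using h
  · simp only [hψ, hγ0]
    rw [Matrix.adjugate_mul, (hW q hq).2.1, one_smul]
  · intro t ht i j
    obtain ⟨hs, -, hd⟩ := hW _ (hγW t ht)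
    have hGq : SmoothMatAt (fun p => (G p).adjugate * G q) (γ t) :=
      hs.adjugate.mul (smoothMatAt_const _)
    have h1 := ((hGq i j).mdiff.hasMFDerivAt.comp_hasMFDerivWithinAt t
      ((hγs t ht).mdifferentiableWithinAt (by simp)).hasMFDerivWithinAt).hasFDerivWithinAt
    have h2 := HasFDerivWithinAt.hasDerivWithinAt (𝕜 := ℝ) (F := ℂ) h1
    refine h2.congr_deriv ?_
    have h3 : ∀ v : TangentSpace 𝓘(ℝ, ℂ) (γ t), dMat (fun p => (G p).adjugate * G q) (γ t) v =
        - (A (γ t) v * ψ t) := fun v => by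
      rw [dMat_mul hs.adjugate (smoothMatAt_const _), dMat_const,
        dMat_adjugate_frame htr hs (hd v), mul_zero, add_zero, hψ, neg_mul, neg_mul, mul_assoc]
    exact congrFun (congrFun (h3 _) i) j

end Frames

/-! ### Transport on a connected surface and the parallel indefinite metric. -/

section Metric

variable {X : Type*} [TopologicalSpace X] [ChartedSpace ℂ X]

theorem adjugate_add_fin_two (M N : Mat) : (M + N).adjugate = M.adjugate + N.adjugate := by
  ext i j
  simp only [Matrix.adjugate_fin_two]
  fin_cases i <;> fin_cases j <;> simp [add_comm]

theorem adjugate_mul_of_det {M : Mat} (h : M.det = 1) : M.adjugate * M = 1 := by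
  rw [Matrix.adjugate_mul, h, one_smul]

theorem mul_adjugate_of_det {M : Mat} (h : M.det = 1) : M * M.adjugate = 1 := by
  rw [Matrix.mul_adjugate, h, one_smul]

theorem adjugate_adjugate_fin_two (M : Mat) : M.adjugate.adjugate = M := by
  ext i j
  simp only [Matrix.adjugate_fin_two]
  fin_cases i <;> fin_cases j <;> simp

theorem det_adjugate_fin_two (M : Mat) : M.adjugate.det = M.det := by
  simp [Matrix.det_adjugate]

/-- On a connected surface any two points are related by an invertible parallel transport. -/
theorem exists_transport [IsManifold 𝓘(ℝ, ℂ) ∞ X] [PreconnectedSpace X] {A : MatForm X}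
    (hA : IsSmoothForm A) (htr : IsTraceFree A) (hflat : IsFlat A) (p q : X) :
    ∃ N : Mat, N.det = 1 ∧ IsTransport A p q N ∧ IsTransport A q p N.adjugate := by
  set R : X → Prop := fun q =>
    ∃ N : Mat, N.det = 1 ∧ IsTransport A p q N ∧ IsTransport A q p N.adjugate with hR
  -- Any two points of `W` are joined inside a chart, so reachability is constant on `W`; hence both
  -- it and its negation are open conditions.
  have step : ∀ x, ∃ W ∈ 𝓝 x, ∀ y ∈ W, ∀ z ∈ W, R y → R z := by
    intro x
    obtain ⟨G, W, hW, hG, ht⟩ := exists_frame_transport hA htr hflat x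
    refine ⟨W, hW, fun y hy z hz ⟨N, hN, h1, h2⟩ => ⟨(G z).adjugate * G y * N, ?_, ?_, ?_⟩⟩
    · rw [Matrix.det_mul, Matrix.det_mul, det_adjugate_fin_two, (hG y hy).2.1, (hG z hz).2.1, hN]
      norm_num
    · exact h1.trans (ht y hy z hz)
    · rw [Matrix.adjugate_mul_distrib, Matrix.adjugate_mul_distrib, adjugate_adjugate_fin_two]
      exact (ht z hz y hy).trans h2
  have hclopen : IsClopen {q | R q} := by
    constructor
    · rw [← isOpen_compl_iff, isOpen_iff_mem_nhds]
      intro x hx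
      obtain ⟨W, hW, h⟩ := step x
      exact mem_of_superset hW fun y hy hRy => hx (h y hy x (mem_of_mem_nhds hW) hRy)
    · rw [isOpen_iff_mem_nhds]
      intro x hx
      obtain ⟨W, hW, h⟩ := step x
      exact mem_of_superset hW fun y hy => h x (mem_of_mem_nhds hW) y hy hx
  have hp : R p := by
    obtain ⟨G, W, hW, hG, ht⟩ := exists_frame_transport hA htr hflat p
    have hp := mem_of_mem_nhds hW
    have h1 := ht p hp p hp
    rw [adjugate_mul_of_det (hG p hp).2.1] at h1
    exact ⟨1, by simp, h1, by simpa using h1⟩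
  exact eq_univ_iff_forall.1 (hclopen.eq_univ ⟨p, hp⟩) q

theorem invariant_of_conj {S T M J : Mat} (hTS : T * S = 1)
    (h : (S * M * T)ᴴ * J * (S * M * T) = J) : Mᴴ * (Sᴴ * J * S) * M = Sᴴ * J * S := by
  obtain ⟨U, hU⟩ : ∃ U, U = S * M * T := ⟨_, rfl⟩
  have h2 : S * M = U * S := by rw [hU, mul_assoc _ T, hTS, mul_one]
  rw [← hU] at h
  calc Mᴴ * (Sᴴ * J * S) * M = (S * M)ᴴ * J * (S * M) := by
        rw [Matrix.conjTranspose_mul]; simp only [mul_assoc]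
    _ = Sᴴ * (Uᴴ * J * U) * S := by
        rw [h2, Matrix.conjTranspose_mul]; simp only [mul_assoc]
    _ = _ := by rw [h]

/-- An indefinite Hermitian form that is invariant under a real monodromy group. -/
theorem exists_invariant_form {A : MatForm X} (h : HasRealMonodromy A) :
    ∃ (p₀ : X) (H₀ : Mat), H₀.IsHermitian ∧ H₀.det.re < 0 ∧
      ∀ M : Mat, IsTransport A p₀ p₀ M → Mᴴ * H₀ * M = H₀ := by
  obtain ⟨p₀, T, hT⟩ := h
  set S : Mat := ((T⁻¹ : GL (Fin 2) ℂ) : Mat) with hS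
  have hTS : (T : Mat) * S = 1 := by rw [hS, ← Units.val_mul, mul_inv_cancel, Units.val_one]
  set J : Mat := !![1, 0; 0, -1] with hJ
  refine ⟨p₀, Sᴴ * J * S, ?_, ?_, fun M hM => ?_⟩
  · refine Matrix.isHermitian_conjTranspose_mul_mul S ?_
    ext i j
    fin_cases i <;> fin_cases j <;> simp [hJ]
  · have hd : S.det ≠ 0 := fun h0 => by
      have := congrArg Matrix.det hTS
      rw [Matrix.det_mul, h0, mul_zero, Matrix.det_one] at this
      exact zero_ne_one this
    have hJd : J.det = -1 := by simp [hJ, Matrix.det_fin_two]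
    rw [Matrix.det_mul, Matrix.det_mul, hJd, Matrix.det_conjTranspose]
    have : star S.det * -1 * S.det = ((-Complex.normSq S.det : ℝ) : ℂ) := by
      push_cast
      rw [← Complex.mul_conj]
      simp only [Complex.star_def]
      ring
    rw [this, Complex.ofReal_re]
    linarith [Complex.normSq_pos.2 hd]
  · exact invariant_of_conj hTS (hT M hM).1

/-- A flat connection with real monodromy has a parallel indefinite Hermitian metric. -/
theorem exists_isParallelMetric [IsManifold 𝓘(ℝ, ℂ) ∞ X] [PreconnectedSpace X] {A : MatForm X}
    (hA : IsSmoothForm A) (htr : IsTraceFree A) (hflat : IsFlat A) (hreal : HasRealMonodromy A) :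
    ∃ H : X → Mat, IsParallelMetric A H := by
  obtain ⟨p₀, H₀, hherm, hneg, hinv⟩ := exists_invariant_form hreal
  choose N hN hN1 hN2 using exists_transport hA htr hflat p₀
  set H : X → Mat := fun q => (N q).adjugateᴴ * H₀ * (N q).adjugate with hH
  -- Two transports from `q` to `p₀` differ by the transport along a loop at `p₀`, which preserves
  -- `H₀`. So `H q` can be computed from any of them.
  have hwell : ∀ (q : X) (N' : Mat), N'.det = 1 → IsTransport A q p₀ N'.adjugate →
      H q = N'.adjugateᴴ * H₀ * N'.adjugate := by
    intro q N' hd h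
    have h1 := hinv _ ((hN1 q).trans h)
    have h2 : N'.adjugate = N'.adjugate * N q * (N q).adjugate := by
      rw [mul_assoc, mul_adjugate_of_det (hN q), mul_one]
    rw [h2, Matrix.conjTranspose_mul (N'.adjugate * N q)]
    calc H q = (N q).adjugateᴴ * ((N'.adjugate * N q)ᴴ * H₀ * (N'.adjugate * N q))
          * (N q).adjugate := by rw [h1]
      _ = _ := by noncomm_ring
  -- Choosing near `x` the transport that passes through `x` by a parallel frame makes `H` a
  -- constant form in that frame, which yields both smoothness and parallelism.
  have hlocal : ∀ x, ∃ (G : X → Mat) (C : Mat), (∀ᶠ q in 𝓝 x, SmoothMatAt G q ∧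
      ∀ v : TangentSpace 𝓘(ℝ, ℂ) q, dMat G q v = G q * A q v) ∧
      ∀ᶠ q in 𝓝 x, H q = (G q)ᴴ * C * G q := by
    intro x
    obtain ⟨G, W, hW, hG, ht⟩ := exists_frame_transport hA htr hflat x
    have hx := mem_of_mem_nhds hW
    refine ⟨G, ((N x).adjugate * (G x).adjugate)ᴴ * H₀ * ((N x).adjugate * (G x).adjugate),
      mem_of_superset hW fun q hq => ⟨(hG q hq).1, (hG q hq).2.2⟩,
      mem_of_superset hW fun q hq => ?_⟩
    have hadj : ((G q).adjugate * G x * N x).adjugate = (N x).adjugate * (G x).adjugate * G q := by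
      rw [Matrix.adjugate_mul_distrib, Matrix.adjugate_mul_distrib, adjugate_adjugate_fin_two,
        mul_assoc]
    have := hwell q ((G q).adjugate * G x * N x) ?_ ?_
    · rw [Set.mem_ofPred_eq, this, hadj, Matrix.conjTranspose_mul _ (G q)]
      noncomm_ring
    · rw [Matrix.det_mul, Matrix.det_mul, det_adjugate_fin_two, (hG q hq).2.1, (hG x hx).2.1, hN]
      norm_num
    · rw [hadj, mul_assoc]
      exact (ht q hq x hx).trans (hN2 x)
  refine ⟨H, fun i j x => ?_, fun q => Matrix.isHermitian_conjTranspose_mul_mul _ hherm,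
    fun q => ?_, fun x v => ?_⟩
  · obtain ⟨G, C, hG, hHG⟩ := hlocal x
    have hs := hG.self_of_nhds.1
    have h1 := (hs.conjTranspose.mul (smoothMatAt_const C)).mul hs
    exact ContMDiffAt.congr_of_eventuallyEq (h1 i j) (hHG.mono fun q hq => by simp only [hq])
  · have h1 : (N q).adjugate.det = 1 := by rw [det_adjugate_fin_two, hN]
    simp only [hH, Matrix.det_mul, Matrix.det_conjTranspose, h1, star_one, one_mul, mul_one]
    exact hneg
  · obtain ⟨G, C, hG, hHG⟩ := hlocal x
    obtain ⟨hs, hd⟩ := hG.self_of_nhds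
    rw [dMat_congr hHG, dMat_mul (hs.conjTranspose.mul (smoothMatAt_const C)) hs,
      dMat_mul hs.conjTranspose (smoothMatAt_const C), dMat_conjTranspose hs, dMat_const, hd,
      hHG.self_of_nhds, Matrix.conjTranspose_mul]
    noncomm_ring

/-! ### The reality gauge determined by a parallel metric. -/

variable {A : MatForm X} {H h : X → Mat}

theorem IsParallelMetric.smoothMatAt (hH : IsParallelMetric A H) (p : X) : SmoothMatAt H p :=
  fun i j => hH.smooth i j p

theorem IsParallelMetric.det_ne_zero (hH : IsParallelMetric A H) (p : X) : (H p).det ≠ 0 :=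
  fun h0 => by simpa [h0] using hH.indefinite p

/-- By Jacobi's formula the derivative of `det H` is `det H` times `tr A* + tr A`, and both traces
vanish. -/
theorem IsParallelMetric.det_eq [IsManifold 𝓘(ℝ, ℂ) ∞ X] [PreconnectedSpace X]
    (htr : IsTraceFree A) (hH : IsParallelMetric A H) (p q : X) : (H p).det = (H q).det := by
  refine eq_of_dFun_eq_zero (f := fun q => (H q).det) (fun q => (hH.smoothMatAt q).det)
    (fun q v => ?_) p q
  rw [dFun_det (hH.smoothMatAt q), hH.parallel, mul_add, Matrix.trace_add, ← mul_assoc,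
    ← mul_assoc, Matrix.adjugate_mul, Matrix.trace_mul_cycle, Matrix.mul_adjugate]
  simp [Matrix.trace_conjTranspose, htr q v]

/-- The standard symplectic matrix. -/
def symp : Mat := !![0, 1; -1, 0]

/-- This is the identity `sl₂ = sp₂`, that is `Nᵀε = -εN`, applied to the conjugate of `M`. -/
theorem conjTranspose_mul_symp {M : Mat} (hM : M.trace = 0) : Mᴴ * symp = - (symp * conjMat M) := by
  rw [Matrix.trace_fin_two] at hM
  have h1 : conj (M 0 0) + conj (M 1 1) = 0 := by rw [← map_add, hM, map_zero]
  rw [Matrix.eta_fin_two (Mᴴ * symp), Matrix.eta_fin_two (-(symp * conjMat M))]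
  simp only [symp, conjMat, Matrix.neg_apply, Matrix.mul_apply, Fin.sum_univ_two,
    Matrix.conjTranspose_apply, Matrix.map_apply, Matrix.of_apply, Matrix.cons_val_zero,
    Matrix.cons_val_one, Matrix.cons_val', Matrix.cons_val_fin_one, RCLike.star_def, eq_neg_of_add_eq_zero_right h1]
  ring_nf

theorem IsRealityGauge.smoothMatAt (hh : IsRealityGauge A h) (p : X) : SmoothMatAt h p :=
  fun i j => hh.smooth i j p

theorem IsRealityGauge.dMat_eq (hh : IsRealityGauge A h) (p : X)
    (v : TangentSpace 𝓘(ℝ, ℂ) p) : dMat h p v = h p * conjMat (A p v) - A p v * h p := by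
  have hu : IsUnit (h p).det := by rw [hh.det_eq_one]; exact isUnit_one
  rw [hh.gauge, mul_add, mul_assoc, Matrix.mul_nonsing_inv_cancel_left _ _ hu,
    Matrix.mul_nonsing_inv_cancel_left _ _ hu, add_sub_cancel_left]

/-- The metric identifies `V̄` with the dual of `V`, and `ε` identifies `V̄` with its own dual;
combining them gives a parallel isomorphism from `V̄` to `V`. The adjugate replaces `H⁻¹`, being a
constant multiple of it and linear in `H`. Since `det (c • ε) = c ^ 2`, the constant `c` is a square
root of `(det H)⁻¹`. -/
theorem exists_isRealityGauge_of_metric [IsManifold 𝓘(ℝ, ℂ) ∞ X] [ConnectedSpace X]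
    (htr : IsTraceFree A) (hH : IsParallelMetric A H) :
    ∃ c : ℂ, IsRealityGauge A fun q => (H q).adjugate * (c • symp) := by
  obtain ⟨p₀⟩ := (inferInstance : Nonempty X)
  obtain ⟨c, hc⟩ := IsAlgClosed.exists_pow_nat_eq ((H p₀).det)⁻¹ two_pos
  have hs : ∀ p, SmoothMatAt (fun q => (H q).adjugate * (c • symp)) p := fun p =>
    (hH.smoothMatAt p).adjugate.mul (smoothMatAt_const _)
  have hdet : ∀ p, ((H p).adjugate * (c • symp)).det = 1 := fun p => by
    have h1 : symp.det = 1 := by simp [symp, Matrix.det_fin_two]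
    rw [Matrix.det_mul, det_adjugate_fin_two, Matrix.det_smul, Fintype.card_fin, hc, h1, mul_one,
      hH.det_eq htr p p₀, mul_inv_cancel₀ (hH.det_ne_zero p₀)]
  refine ⟨c, fun i j p => hs p i j, hdet, fun p v => ?_⟩
  have hu : IsUnit ((H p).adjugate * (c • symp)).det := by rw [hdet]; exact isUnit_one
  have hd : dMat (fun q => (H q).adjugate * (c • symp)) p v =
      (H p).adjugate * (c • symp) * conjMat (A p v) - A p v * ((H p).adjugate * (c • symp)) := by
    have h1 : (A p v)ᴴ.trace = 0 := by rw [Matrix.trace_conjTranspose, htr, star_zero]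
    rw [dMat_mul (hH.smoothMatAt p).adjugate (smoothMatAt_const _), dMat_const,
      dMat_adjugate (hH.smoothMatAt p), hH.parallel, adjugate_add_fin_two,
      Matrix.adjugate_mul_distrib, Matrix.adjugate_mul_distrib, adjugate_eq_neg h1,
      adjugate_eq_neg (htr p v), mul_zero, add_zero, add_mul, mul_neg, neg_mul, mul_assoc,
      Matrix.mul_smul, conjTranspose_mul_symp (htr p v)]
    simp only [Matrix.mul_smul, Matrix.smul_mul, mul_neg, neg_mul, smul_neg, neg_neg, mul_assoc,
      sub_eq_add_neg]
  rw [hd, mul_sub, Matrix.nonsing_inv_mul_cancel_left _ _ hu, mul_assoc]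
  abel

end Metric

/-! ### Schur's lemma and uniqueness of the reality gauge up to scalars. -/

section Schur

theorem adjugate_sub_fin_two (M N : Mat) : (M - N).adjugate = M.adjugate - N.adjugate := by
  rw [eq_sub_iff_add_eq, ← adjugate_add_fin_two, sub_add_cancel]

/-- The kernel line field of a singular, nowhere vanishing, parallel endomorphism. -/
def kerSub {X : Type*} (B : X → Mat) (p : X) : Submodule ℂ Fib := LinearMap.ker (Matrix.mulVecLin (B p))

theorem mem_kerSub {X : Type*} {B : X → Mat} {p : X} {w : Fib} : w ∈ kerSub B p ↔ ∀ i, B p i 0 * w 0 + B p i 1 * w 1 = 0 := by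
  rw [kerSub, LinearMap.mem_ker, Matrix.mulVecLin_apply, funext_iff]
  simp [Matrix.mulVec, dotProduct, Fin.sum_univ_two]


variable {X : Type*} [TopologicalSpace X] [ChartedSpace ℂ X] {A : MatForm X}

/-- `B` is a smooth parallel endomorphism of `(V, d + A)`. -/
structure IsParallelEnd (A : MatForm X) (B : X → Mat) : Prop where
  smooth : ∀ p, SmoothMatAt B p
  parallel : ∀ (p : X) (v : TangentSpace 𝓘(ℝ, ℂ) p), dMat B p v = B p * A p v - A p v * B p

variable {B : X → Mat}

theorem IsParallelEnd.sub_scalar (hB : IsParallelEnd A B) (μ : ℂ) :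
    IsParallelEnd A fun q => B q - μ • (1 : Mat) where
  smooth p := (hB.smooth p).sub (smoothMatAt_const _)
  parallel p v := by
    rw [dMat_sub (hB.smooth p) (smoothMatAt_const _), dMat_const, hB.parallel, sub_mul, mul_sub,
      Matrix.smul_mul, Matrix.mul_smul, one_mul, mul_one]
    abel

/-- The derivative of `B` is a commutator with `B`, and its trace against `adj B` vanishes because
`adj B` commutes with `B`. -/
theorem IsParallelEnd.det_eq [IsManifold 𝓘(ℝ, ℂ) ∞ X] [PreconnectedSpace X]
    (hB : IsParallelEnd A B) (p q : X) : (B p).det = (B q).det := by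
  refine eq_of_dFun_eq_zero (f := fun q => (B q).det) (fun q => (hB.smooth q).det)
    (fun q v => ?_) p q
  rw [dFun_det (hB.smooth q), hB.parallel, mul_sub, Matrix.trace_sub, ← mul_assoc,
    Matrix.adjugate_mul, ← mul_assoc, Matrix.trace_mul_cycle, Matrix.mul_adjugate, sub_self]

/-- A parallel endomorphism that vanishes at a point vanishes near this point. -/
theorem IsParallelEnd.eventually_eq_zero [IsManifold 𝓘(ℝ, ℂ) ∞ X] (hA : IsSmoothForm A)
    (htr : IsTraceFree A) (hflat : IsFlat A) (hB : IsParallelEnd A B) {p : X} (hp : B p = 0) :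
    ∀ᶠ q in 𝓝 p, B q = 0 := by
  obtain ⟨G, hG⟩ := exists_flat_frame hA htr hflat p
  have hc : ∀ᶠ q in 𝓝 p, G q * B q * (G q).adjugate = G p * B p * (G p).adjugate := by
    refine eventually_eq_of_dMat_eq_zero (F := fun q => G q * B q * (G q).adjugate)
      (hG.mono fun q ⟨hs, _, hd⟩ => ⟨(hs.mul (hB.smooth q)).mul hs.adjugate, fun v => ?_⟩)
    rw [dMat_mul (hs.mul (hB.smooth q)) hs.adjugate, dMat_mul hs (hB.smooth q),
      dMat_adjugate_frame htr hs (hd v), hd, hB.parallel]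
    noncomm_ring
  filter_upwards [hc, hG] with q hq ⟨_, hdet, _⟩
  rw [hp, mul_zero, zero_mul] at hq
  calc B q = (G q).adjugate * (G q * B q * (G q).adjugate) * G q := by
        rw [← mul_assoc, ← mul_assoc, adjugate_mul_of_det hdet, one_mul, mul_assoc,
          adjugate_mul_of_det hdet, mul_one]
    _ = 0 := by rw [hq, mul_zero, zero_mul]

theorem IsParallelEnd.isOpen_ne_zero (hB : IsParallelEnd A B) (i j : Fin 2) :
    IsOpen {q | B q i j ≠ 0} :=
  isOpen_ne_fun (continuous_iff_continuousAt.2 fun q => (hB.smooth q i j).continuousAt)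
    continuous_const

theorem IsParallelEnd.eq_zero_of_eq_zero [IsManifold 𝓘(ℝ, ℂ) ∞ X] [PreconnectedSpace X]
    (hA : IsSmoothForm A) (htr : IsTraceFree A) (hflat : IsFlat A) (hB : IsParallelEnd A B) {p : X}
    (hp : B p = 0) (q : X) : B q = 0 := by
  have hclopen : IsClopen {q | B q = 0} := by
    constructor
    · have : {q | B q = 0} = ⋂ i, ⋂ j, {q | B q i j ≠ 0}ᶜ := by
        ext q
        simp [← Matrix.ext_iff]
      rw [this]
      exact isClosed_iInter fun i => isClosed_iInter fun j => (hB.isOpen_ne_zero i j).isClosed_compl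
    · exact isOpen_iff_mem_nhds.2 fun x hx => hB.eventually_eq_zero hA htr hflat hx
  exact eq_univ_iff_forall.1 (hclopen.eq_univ ⟨p, hp⟩) q

/-- Near a point where `B i j ≠ 0` the row `i` is nonzero, and the vector annihilated by that row
spans the kernel because a vanishing determinant makes the rows proportional. -/
theorem isLineSubbundle_kerSub (hB : IsParallelEnd A B) (hdet : ∀ p, (B p).det = 0)
    (hne : ∀ p, B p ≠ 0) : IsLineSubbundle (kerSub B) := by
  intro p
  obtain ⟨i, j, hij⟩ : ∃ i j, B p i j ≠ 0 := by
    by_contra! h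
    exact hne p (Matrix.ext h)
  refine ⟨{q | B q i j ≠ 0}, fun q => ![B q i 1, - B q i 0], hB.isOpen_ne_zero i j, hij, ?_, ?_⟩
  · refine fun q _ => ContMDiffAt.contMDiffWithinAt (contMDiffAt_pi_space.2 ?_)
    exact Fin.forall_fin_two.2 ⟨hB.smooth q i 1, SmoothAt.neg (hB.smooth q i 0)⟩
  · intro q hq
    have hd := hdet q
    rw [Matrix.det_fin_two] at hd
    have hrow : B q i 0 ≠ 0 ∨ B q i 1 ≠ 0 := by
      by_contra! h
      exact hq (by fin_cases j; exacts [h.1, h.2])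
    refine ⟨fun h0 => ?_, ?_⟩
    · have h1 := congrFun h0 0
      have h2 := congrFun h0 1
      simp at h1 h2
      tauto
    · ext w
      rw [mem_kerSub, Submodule.mem_span_singleton]
      constructor
      · intro hw
        rcases hrow with h | h
        · refine ⟨- w 1 / B q i 0, ?_⟩
          rw [← List.ofFn_inj]
          simp
          refine ⟨?_, by field_simp⟩
          field_simp
          linear_combination - hw i
        · refine ⟨w 0 / B q i 1, ?_⟩
          rw [← List.ofFn_inj]
          simp
          refine ⟨by field_simp, ?_⟩
          field_simp
          linear_combination - hw i
      · rintro ⟨a, rfl⟩ k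
        simp only [Pi.smul_apply, smul_eq_mul, Matrix.cons_val_zero, Matrix.cons_val_one]
        fin_cases i <;> fin_cases k <;> simp <;> first | ring1 | linear_combination a * hd | linear_combination (-a) * hd

/-- Differentiating `B s = 0` and using `dB = BA - AB` gives `B (ds + A s) = A B s = 0`. -/
theorem isParallelSub_kerSub (hB : IsParallelEnd A B) : IsParallelSub A (kerSub B) := by
  intro p s ⟨hs, hsm⟩ v
  have hsp := hsm.self_of_nhds
  rw [mem_kerSub]
  intro i
  have h0 : dFun (fun q => B q i 0 * s q 0 + B q i 1 * s q 1) p v = 0 := by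
    rw [dFun_congr (g := fun _ => 0) (hs.mono fun q hq => mem_kerSub.1 hq i), dFun_const]
  have hb := fun j => hB.smooth p i j
  have hs' := fun j => smoothAt_apply hsp j
  rw [dFun_add ((hb 0).mul (hs' 0)) ((hb 1).mul (hs' 1)), dFun_mul (hb 0) (hs' 0),
    dFun_mul (hb 1) (hs' 1), ← dMat_apply, ← dMat_apply, ← dSec_apply hsp, ← dSec_apply hsp,
    hB.parallel] at h0
  have h1 := mem_kerSub.1 hs.self_of_nhds
  have e0 := h1 0
  have e1 := h1 1
  simp only [Matrix.sub_apply, Matrix.mul_apply, Fin.sum_univ_two] at h0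
  simp only [covDeriv, Pi.add_apply, Matrix.mulVec, dotProduct, Fin.sum_univ_two]
  linear_combination h0 + A p v i 0 * e0 + A p v i 1 * e1

/-- Schur's lemma for parallel endomorphisms of irreducible flat connections. -/
theorem IsParallelEnd.eq_scalar [IsManifold 𝓘(ℝ, ℂ) ∞ X] [ConnectedSpace X] (hA : IsSmoothForm A)
    (htr : IsTraceFree A) (hflat : IsFlat A) (hirr : IsIrreducibleConn A)
    (hB : IsParallelEnd A B) : ∃ μ : ℂ, ∀ q, B q = μ • (1 : Mat) := by
  obtain ⟨p₀⟩ := (inferInstance : Nonempty X)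
  obtain ⟨s, hs⟩ := IsAlgClosed.exists_pow_nat_eq ((B p₀).trace ^ 2 - 4 * (B p₀).det) two_pos
  -- An eigenvalue of `B p₀` by the quadratic formula. The determinant of `B - μ` is then zero at
  -- `p₀`, hence everywhere.
  set μ : ℂ := ((B p₀).trace + s) / 2 with hμ
  have hC := hB.sub_scalar μ
  have hdet : ∀ p, (B p - μ • (1 : Mat)).det = 0 := fun p => by
    rw [hC.det_eq p p₀]
    rw [Matrix.trace_fin_two, Matrix.det_fin_two] at hs
    rw [Matrix.trace_fin_two] at hμ
    simp only [Matrix.det_fin_two, Matrix.sub_apply, Matrix.smul_apply, smul_eq_mul,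
      Matrix.one_apply_eq, Matrix.one_apply_ne zero_ne_one, Matrix.one_apply_ne one_ne_zero]
    rw [hμ]
    linear_combination hs / 4
  refine ⟨μ, fun q => ?_⟩
  -- If `B - μ` never vanishes, its kernel is an invariant line subbundle, which irreducibility
  -- excludes; if it vanishes once, it vanishes identically.
  by_cases h : ∀ p, B p - μ • (1 : Mat) ≠ 0
  · exact absurd (isParallelSub_kerSub hC) (hirr _ (isLineSubbundle_kerSub hC hdet h))
  · obtain ⟨p, hp⟩ := not_forall_not.1 h
    exact sub_eq_zero.1 (hC.eq_zero_of_eq_zero hA htr hflat hp q)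

/-- Two reality gauges differ by a parallel endomorphism. -/
theorem IsRealityGauge.isParallelEnd (htr : IsTraceFree A) {h k : X → Mat}
    (hh : IsRealityGauge A h) (hk : IsRealityGauge A k) :
    IsParallelEnd A fun q => h q * (k q).adjugate where
  smooth p := (hh.smoothMatAt p).mul (hk.smoothMatAt p).adjugate
  parallel p v := by
    have h1 : (conjMat (A p v)).trace = 0 := by
      have := htr p v
      rw [Matrix.trace_fin_two] at this ⊢
      simp only [conjMat, Matrix.map_apply]
      rw [← map_add, this, map_zero]
    have h2 : dMat (fun q => (k q).adjugate) p v =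
        (k p).adjugate * A p v - conjMat (A p v) * (k p).adjugate := by
      rw [dMat_adjugate (hk.smoothMatAt p), hk.dMat_eq, adjugate_sub_fin_two,
        Matrix.adjugate_mul_distrib, Matrix.adjugate_mul_distrib, adjugate_eq_neg h1,
        adjugate_eq_neg (htr p v), mul_neg, neg_mul]
      abel
    rw [dMat_mul (hh.smoothMatAt p) (hk.smoothMatAt p).adjugate, h2, hh.dMat_eq]
    noncomm_ring

/-- Every reality gauge is a multiple of the one defined by a parallel metric. -/
theorem IsRealityGauge.eq_smul [IsManifold 𝓘(ℝ, ℂ) ∞ X] [ConnectedSpace X] (hA : IsSmoothForm A)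
    (htr : IsTraceFree A) (hflat : IsFlat A) (hirr : IsIrreducibleConn A) {H h : X → Mat}
    (hH : IsParallelMetric A H) (hh : IsRealityGauge A h) :
    ∃ c : ℂ, ∀ q, h q = c • ((H q).adjugate * symp) := by
  obtain ⟨c, hk⟩ := exists_isRealityGauge_of_metric htr hH
  obtain ⟨μ, hμ⟩ := (hh.isParallelEnd htr hk).eq_scalar hA htr hflat hirr
  refine ⟨μ * c, fun q => ?_⟩
  have h1 := congrArg (· * ((H q).adjugate * (c • symp))) (hμ q)
  simp only [mul_assoc (h q)] at h1
  rw [adjugate_mul_of_det (hk.det_eq_one q), mul_one] at h1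
  rw [h1, Matrix.smul_mul, one_mul, Matrix.mul_smul, smul_smul]

end Schur

/-! ### Explicit Birkhoff factorisation and the isotropy criterion for `S = S^#`. -/

section BigCell

/-- The matrix with columns `u` and `w`. -/
def colMat (u w : Fib) : Mat := !![u 0, w 0; u 1, w 1]

theorem mul_colMat (M : Mat) (u w : Fib) : M * colMat u w = colMat (M *ᵥ u) (M *ᵥ w) := by
  rw [Matrix.eta_fin_two (M * colMat u w)]
  simp [colMat, Matrix.mul_apply, Fin.sum_univ_two, Matrix.mulVec, dotProduct]

theorem colMat_mul_diag (u w : Fib) (a b : ℂ) :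
    colMat u w * !![a, 0; 0, b] = colMat (a • u) (b • w) := by
  simp [colMat, mul_comm]

theorem det_colMat_ne_zero {S L : Submodule ℂ Fib} (hc : IsCompl S L) {s l : Fib} (hs : s ∈ S)
    (hl : l ∈ L) (hs0 : s ≠ 0) (hl0 : l ≠ 0) : (colMat s l).det ≠ 0 := by
  intro h
  rw [colMat, Matrix.det_fin_two_of] at h
  have key : ∀ a b : ℂ, a • s = b • l → a = 0 := fun a b hab => by
    have h1 : a • s ∈ S ⊓ L := ⟨S.smul_mem a hs, hab ▸ L.smul_mem b hl⟩
    rw [hc.inf_eq_bot, Submodule.mem_bot] at h1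
    exact (smul_eq_zero.1 h1).resolve_right hs0
  refine hl0 (funext (Fin.forall_fin_two.2 ⟨key (l 0) (s 0) ?_, key (l 1) (s 1) ?_⟩))
  · refine funext (Fin.forall_fin_two.2 ⟨?_, ?_⟩) <;> simp only [Pi.smul_apply, smul_eq_mul]
    · ring
    · linear_combination -h
  · refine funext (Fin.forall_fin_two.2 ⟨?_, ?_⟩) <;> simp only [Pi.smul_apply, smul_eq_mul]
    · linear_combination h
    · ring

theorem splitGauge_mul_colMat {S L : Submodule ℂ Fib} (hc : IsCompl S L) {s l : Fib} (hs : s ∈ S)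
    (hl : l ∈ L) (μ : ℂ) :
    splitGauge hc μ * colMat s l = colMat s l * !![1, 0; 0, μ] := by
  rw [mul_colMat, colMat_mul_diag, splitGauge, LinearMap.toMatrix'_mulVec,
    LinearMap.toMatrix'_mulVec]
  simp only [LinearMap.add_apply, LinearMap.smul_apply, one_smul]
  rw [Submodule.projection_apply_of_mem_left hc hs, (Submodule.projection_apply_eq_zero_iff hc).2 hl,
    Submodule.projection_apply_of_mem_left hc.symm hl,
    (Submodule.projection_apply_eq_zero_iff hc.symm).2 hs, smul_zero, add_zero, zero_add]

theorem conjMat_mul (M N : Mat) : conjMat (M * N) = conjMat M * conjMat N := Matrix.map_mul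

theorem det_conjMat (M : Mat) : (conjMat M).det = conj M.det := (RingHom.map_det _ M).symm

/-- In the basis `s, l` the gauge `g(μ)` is `diag(1, μ)`. The conjugation in the last factor cancels
the one in `-μ̄⁻¹`, so that the loop is rational in `μ`. -/
theorem gaugeLoop_eq {S L : Submodule ℂ Fib} (hc : IsCompl S L) {s l : Fib} (hs : s ∈ S)
    (hl : l ∈ L) {T : Mat} (hT : colMat s l * T = 1) (h : Mat) {μ : ℂ} (hμ : μ ≠ 0) :
    gaugeLoop hc h μ = colMat s l * (!![1, 0; 0, μ⁻¹] * (T * h * conjMat (colMat s l)) *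
      !![1, 0; 0, -μ⁻¹]) * conjMat T := by
  set P := colMat s l with hP
  have hT' : T * P = 1 := mul_eq_one_comm.1 hT
  have hg : ∀ ν, splitGauge hc ν = P * !![1, 0; 0, ν] * T := fun ν => by
    rw [← splitGauge_mul_colMat hc hs hl, mul_assoc, hT, mul_one]
  have hinv : (splitGauge hc μ)⁻¹ = P * !![1, 0; 0, μ⁻¹] * T := by
    refine Matrix.inv_eq_right_inv ?_
    have hD : (!![1, 0; 0, μ] : Mat) * !![1, 0; 0, μ⁻¹] = 1 := by
      simp [hμ, Matrix.one_fin_two]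
    calc splitGauge hc μ * (P * !![1, 0; 0, μ⁻¹] * T)
        = P * (!![1, 0; 0, μ] * (T * P) * !![1, 0; 0, μ⁻¹]) * T := by
          rw [hg]; simp only [mul_assoc]
      _ = 1 := by rw [hT', mul_one, hD, mul_one, hT]
  have hconj : conjMat !![1, 0; 0, -(conj μ)⁻¹] = !![1, 0; 0, -μ⁻¹] := by
    rw [conjMat, Matrix.eta_fin_two (Matrix.map _ _)]
    simp
  rw [gaugeLoop, hinv, hg, conjMat_mul, conjMat_mul, hconj]
  simp only [mul_assoc]

/-- The loop `diag(1, μ⁻¹) M diag(1, -μ⁻¹)` has a Birkhoff factorisation if `M₁₀ ≠ 0`. -/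
theorem diag_conj_factorisation (M : Mat) (hM : M 1 0 ≠ 0) {μ : ℂ} (hμ : μ ≠ 0) :
    !![1, 0; 0, μ⁻¹] * M * !![1, 0; 0, -μ⁻¹] = μ ^ (-1 : ℤ) •
      (!![1, M 0 0 / M 1 0 * μ; 0, 1] * !![0, M.det / M 1 0; M 1 0, - M 1 1 * μ⁻¹]) := by
  rw [Matrix.eta_fin_two M]
  simp [Matrix.det_fin_two]
  refine ⟨⟨?_, ?_⟩, ?_⟩ <;> field_simp <;> ring

/-- The determinant of the loop is a constant times `μ⁻²`, which forces the central factor `μ⁻¹`.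
The constant matrices `P` and `P'` are absorbed into the two Birkhoff factors. -/
theorem inBigCell_of_apply_ne_zero {γ : ℂ → Mat} {P P' M : Mat} (hP : P.det ≠ 0) (hP' : P'.det ≠ 0)
    (hM : M.det ≠ 0) (hM' : M 1 0 ≠ 0) (hγ : ∀ μ : ℂ, μ ≠ 0 →
      γ μ = P * (!![1, 0; 0, μ⁻¹] * M * !![1, 0; 0, -μ⁻¹]) * P') : InBigCell γ := by
  refine ⟨-1, fun μ => P * !![1, M 0 0 / M 1 0 * μ; 0, 1],
    fun μ => !![0, M.det / M 1 0; M 1 0, - M 1 1 * μ] * P', fun i j => ?_, fun i j => ?_,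
    fun μ => ?_, fun μ => ?_, fun μ hμ => ?_⟩
  · simp only [Matrix.mul_apply, Fin.sum_univ_two]
    fin_cases j <;> simp <;> fun_prop
  · simp only [Matrix.mul_apply, Fin.sum_univ_two]
    fin_cases i <;> simp <;> fun_prop
  · rw [Matrix.det_mul, Matrix.det_fin_two_of]
    simpa using hP
  · rw [Matrix.det_mul, Matrix.det_fin_two_of]
    have : (0 * (-M 1 1 * μ) - M.det / M 1 0 * M 1 0) = - M.det := by field_simp; ring
    rw [this]
    exact mul_ne_zero (neg_ne_zero.2 hM) hP'
  · rw [hγ μ hμ, diag_conj_factorisation M hM' hμ]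
    simp only [Matrix.mul_smul, Matrix.smul_mul, mul_assoc]

theorem mem_span_of_mul_eq {s w : Fib} (hs : s ≠ 0) (h : w 0 * s 1 = w 1 * s 0) :
    w ∈ Submodule.span ℂ {s} := by
  rw [Submodule.mem_span_singleton]
  by_cases h0 : s 0 = 0
  · have h1 : s 1 ≠ 0 := fun h1 => hs (funext (Fin.forall_fin_two.2 ⟨h0, h1⟩))
    have hw : w 0 = 0 := by
      rw [h0, mul_zero] at h
      exact (mul_eq_zero.1 h).resolve_right h1
    refine ⟨w 1 / s 1, funext (Fin.forall_fin_two.2 ⟨?_, ?_⟩)⟩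
    · simp [h0, hw]
    · simp [h1]
  · refine ⟨w 0 / s 0, funext (Fin.forall_fin_two.2 ⟨?_, ?_⟩)⟩
    · simp [h0]
    · simp only [Pi.smul_apply, smul_eq_mul]
      field_simp
      rw [h, mul_comm]

variable {X : Type*} {H : X → Mat} {S : X → Submodule ℂ Fib} {p : X} {s : Fib}

theorem mem_sharp_iff (hS : S p = Submodule.span ℂ {s}) {w : Fib} :
    w ∈ sharp H S p ↔ star s ⬝ᵥ (H p *ᵥ w) = 0 := by
  constructor
  · intro h
    exact h s (hS ▸ Submodule.mem_span_singleton_self s)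
  · intro h u hu
    rw [hS, Submodule.mem_span_singleton] at hu
    obtain ⟨a, rfl⟩ := hu
    rw [star_smul, smul_dotProduct, h, smul_zero]

/-- As `H` is nondegenerate, `S^#` is a line, so it equals `S` as soon as it contains `s`, that is,
when `s` is isotropic. -/
theorem eq_sharp_iff (hS : S p = Submodule.span ℂ {s}) (hs : s ≠ 0) (hH : (H p).det ≠ 0) :
    S p = sharp H S p ↔ star s ⬝ᵥ (H p *ᵥ s) = 0 := by
  constructor
  · intro h
    refine (mem_sharp_iff hS).1 (h ▸ ?_)
    rw [hS]
    exact Submodule.mem_span_singleton_self s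
  · intro h
    refine le_antisymm ?_ fun w hw => ?_
    · rw [hS, Submodule.span_singleton_le_iff_mem]
      exact (mem_sharp_iff hS).2 h
    · have hw' := (mem_sharp_iff hS).1 hw
      rw [Matrix.dotProduct_mulVec] at h hw'
      set r := star s ᵥ* H p with hr
      have hr0 : r ≠ 0 := fun h0 => hs (star_eq_zero.1
        (Matrix.eq_zero_of_vecMul_eq_zero hH h0))
      rw [dotProduct, Fin.sum_univ_two] at h hw'
      rw [hS]
      refine mem_span_of_mul_eq hs ?_
      by_cases h0 : r 0 = 0
      · have h1 : r 1 ≠ 0 := fun h1 => hr0 (funext (Fin.forall_fin_two.2 ⟨h0, h1⟩))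
        refine mul_left_cancel₀ h1 ?_
        linear_combination w 0 * h - s 0 * hw'
      · refine mul_left_cancel₀ h0 ?_
        linear_combination s 1 * hw' - w 1 * h

end BigCell

/-! ### The big cell where `S ≠ S^#`; openness and density of this set. -/

section Main

variable {X : Type*} [TopologicalSpace X] [ChartedSpace ℂ X] {A : MatForm X} {H h : X → Mat}
  {S : X → Submodule ℂ Fib}

theorem IsLineSubbundle.exists_section (hS : IsLineSubbundle S) (p : X) :
    ∃ s : X → Fib, ∀ᶠ q in 𝓝 p, ContMDiffAt 𝓘(ℝ, ℂ) 𝓘(ℝ, Fib) ∞ s q ∧ s q ≠ 0 ∧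
      S q = Submodule.span ℂ {s q} := by
  obtain ⟨W, s, hW, hp, hs, h⟩ := hS p
  refine ⟨s, ?_⟩
  filter_upwards [hW.mem_nhds hp] with q hq
  exact ⟨hs.contMDiffAt (hW.mem_nhds hq), h q hq⟩

theorem colMat_conjTranspose_mul_mul (M : Mat) (u w : Fib) :
    ((colMat u 0)ᴴ * M * colMat w 0) 0 0 = star u ⬝ᵥ (M *ᵥ w) := by
  rw [mul_assoc, mul_colMat, Matrix.mul_apply, Fin.sum_univ_two, dotProduct, Fin.sum_univ_two]
  simp [colMat]

/-- If `h` is a multiple of `H⁻¹ ε`, the gauge loop lies in the big cell wherever `S ≠ S^#`. -/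
theorem inBigCell_gaugeLoop {Hp hp : Mat} {S L : Submodule ℂ Fib} (hc : IsCompl S L) {s l : Fib}
    (hs : s ∈ S) (hl : l ∈ L) (hs0 : s ≠ 0) (hl0 : l ≠ 0) (hH : star s ⬝ᵥ (Hp *ᵥ s) ≠ 0)
    (hdet : hp.det = 1) {c : ℂ} (hh : hp = c • (Hp.adjugate * symp)) :
    InBigCell (gaugeLoop hc hp) := by
  have hP := det_colMat_ne_zero hc hs hl hs0 hl0
  set P := colMat s l with hPdef
  have hT : P * P⁻¹ = 1 := Matrix.mul_nonsing_inv P (isUnit_iff_ne_zero.2 hP)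
  have hTd : P⁻¹.det ≠ 0 := fun h0 => by
    have := congrArg Matrix.det hT
    rw [Matrix.det_mul, h0, mul_zero, Matrix.det_one] at this
    exact zero_ne_one this
  have hM : (P⁻¹ * hp * conjMat P).det ≠ 0 := by
    rw [Matrix.det_mul, Matrix.det_mul, hdet, mul_one, det_conjMat]
    exact mul_ne_zero hTd ((map_ne_zero _).2 hP)
  refine inBigCell_of_apply_ne_zero hP (P' := conjMat P⁻¹) ?_ hM ?_
    fun μ hμ => gaugeLoop_eq hc hs hl hT hp hμ
  · rw [det_conjMat]
    exact (map_ne_zero _).2 hTd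
  · intro h0
    have hm : (P⁻¹ * hp * conjMat P) 0 0 ≠ 0 := fun h1 => hM (by
      rw [Matrix.det_fin_two, h0, h1]; ring)
    set m := P⁻¹ * hp * conjMat P with hmdef
    -- The first column of this identity reads `h s̄ = m₀₀ s` when `m₁₀ = 0`.
    have hPm : P * m = hp * conjMat P := by
      rw [hmdef, ← mul_assoc, ← mul_assoc, hT, one_mul]
    have hcol : ∀ i, (hp *ᵥ star s) i = m 0 0 * s i := fun i => by
      have h1 := congrFun (congrFun hPm i) 0
      rw [Matrix.mul_apply, Matrix.mul_apply, Fin.sum_univ_two, Fin.sum_univ_two, h0] at h1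
      rw [Matrix.mulVec, dotProduct, Fin.sum_univ_two]
      fin_cases i <;> simp [hPdef, colMat, conjMat] at h1 ⊢ <;> linear_combination -h1
    have hcol' : hp *ᵥ star s = m 0 0 • s := funext hcol
    -- Since `H * adj H` is scalar, the pairing is a multiple of `s* ε s̄`, which vanishes because
    -- `ε` is skew.
    have hz : star s ⬝ᵥ (Hp *ᵥ (hp *ᵥ star s)) = 0 := by
      rw [Matrix.mulVec_mulVec, hh, Matrix.mul_smul, ← mul_assoc, Matrix.mul_adjugate]
      simp [symp, dotProduct, Fin.sum_univ_two]
      ring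
    rw [hcol', Matrix.mulVec_smul, dotProduct_smul, smul_eq_mul] at hz
    exact hH ((mul_eq_zero.1 hz).resolve_left hm)

theorem smoothMatAt_colMat {s : X → Fib} {p : X}
    (hs : ContMDiffAt 𝓘(ℝ, ℂ) 𝓘(ℝ, Fib) ∞ s p) : SmoothMatAt (fun q => colMat (s q) 0) p := by
  intro i j
  fin_cases i <;> fin_cases j
  · exact smoothAt_apply hs 0
  · exact smoothAt_const 0
  · exact smoothAt_apply hs 1
  · exact smoothAt_const 0

theorem dMat_colMat {s : X → Fib} {p : X} (hs : ContMDiffAt 𝓘(ℝ, ℂ) 𝓘(ℝ, Fib) ∞ s p)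
    (v : TangentSpace 𝓘(ℝ, ℂ) p) :
    dMat (fun q => colMat (s q) 0) p v = colMat (dSec s p v) 0 := by
  ext i j
  fin_cases i <;> fin_cases j
  · exact (dSec_apply hs 0).symm
  · exact dFun_const 0
  · exact (dSec_apply hs 1).symm
  · exact dFun_const 0

/-- Metric compatibility: if `⟨s, s⟩` vanishes near `p`, then `⟨s, ∇_v s⟩` is imaginary. -/
theorem IsParallelMetric.re_eq_zero (hH : IsParallelMetric A H) {s : X → Fib} {p : X}
    (hs : ContMDiffAt 𝓘(ℝ, ℂ) 𝓘(ℝ, Fib) ∞ s p)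
    (hz : ∀ᶠ q in 𝓝 p, star (s q) ⬝ᵥ (H q *ᵥ s q) = 0) (v : TangentSpace 𝓘(ℝ, ℂ) p) :
    (star (s p) ⬝ᵥ (H p *ᵥ covDeriv A s p v)).re = 0 := by
  have hsm := smoothMatAt_colMat hs
  have hHs := hH.smoothMatAt p
  set N : Mat := colMat (covDeriv A s p v) 0 with hN
  -- Sections are padded with a zero column, so that the product rule for matrices applies and `⟨s,
  -- s⟩` is the upper left entry of a matrix product.
  have hNeq : N = dMat (fun q => colMat (s q) 0) p v + A p v * colMat (s p) 0 := by
    rw [dMat_colMat hs, mul_colMat, hN, covDeriv]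
    ext i j
    fin_cases i <;> fin_cases j <;> simp [colMat]
  have h0 : dMat (fun q => (colMat (s q) 0)ᴴ * H q * colMat (s q) 0) p v 0 0 = 0 := by
    rw [dMat_apply, dFun_congr (g := fun _ => 0) (hz.mono fun q hq => by
      rw [colMat_conjTranspose_mul_mul, hq]), dFun_const]
  rw [dMat_mul (hsm.conjTranspose.mul hHs) hsm, dMat_mul hsm.conjTranspose hHs,
    dMat_conjTranspose hsm, hH.parallel, eq_sub_of_add_eq hNeq.symm] at h0
  have h1 : ((N - A p v * colMat (s p) 0)ᴴ * H p
      + (colMat (s p) 0)ᴴ * ((A p v)ᴴ * H p + H p * A p v)) * colMat (s p) 0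
      + (colMat (s p) 0)ᴴ * H p * (N - A p v * colMat (s p) 0)
      = ((colMat (s p) 0)ᴴ * H p * N)ᴴ + (colMat (s p) 0)ᴴ * H p * N := by
    rw [Matrix.conjTranspose_mul, Matrix.conjTranspose_mul, (hH.hermitian p).eq,
      Matrix.conjTranspose_conjTranspose, Matrix.conjTranspose_sub, Matrix.conjTranspose_mul]
    noncomm_ring
  have h2 := (congrFun (congrFun h1 0) 0).symm.trans h0
  rw [Matrix.add_apply, Matrix.conjTranspose_apply, hN, colMat_conjTranspose_mul_mul] at h2
  have h3 := congrArg Complex.re h2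
  rw [Complex.add_re, RCLike.star_def, Complex.conj_re, Complex.zero_re] at h3
  linarith

theorem isOpen_ne_sharp (hH : IsParallelMetric A H) (hS : IsLineSubbundle S) :
    IsOpen {p : X | S p ≠ sharp H S p} := by
  refine isOpen_iff_mem_nhds.2 fun p hp => ?_
  obtain ⟨s, hs⟩ := hS.exists_section p
  obtain ⟨hsp, hs0, hspan⟩ := hs.self_of_nhds
  have hne : star (s p) ⬝ᵥ (H p *ᵥ s p) ≠ 0 := fun h0 =>
    hp ((eq_sharp_iff hspan hs0 (hH.det_ne_zero p)).2 h0)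
  have hsm := smoothMatAt_colMat hsp
  have hcont : ContinuousAt (fun q => star (s q) ⬝ᵥ (H q *ᵥ s q)) p := by
    have h1 := (((hsm.conjTranspose.mul (hH.smoothMatAt p)).mul hsm) 0 0).continuousAt
    simpa only [colMat_conjTranspose_mul_mul] using h1
  filter_upwards [hs, hcont.eventually_ne hne] with q ⟨_, hq0, hqspan⟩ hq
  exact fun h0 => hq ((eq_sharp_iff hqspan hq0 (hH.det_ne_zero q)).1 h0)

theorem dense_ne_sharp (hH : IsParallelMetric A H) (hS : IsLineSubbundle S)
    (hhol : IsHolomorphicSub A S) (hφ : SecondFormNowhereZero A S) :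
    Dense {p : X | S p ≠ sharp H S p} := by
  refine dense_iff_inter_open.2 fun O hO ⟨p, hp⟩ => ?_
  by_contra hcon
  have heq : ∀ q ∈ O, S q = sharp H S q := fun q hq => by
    by_contra hne
    exact hcon ⟨q, hq, hne⟩
  obtain ⟨s, hs⟩ := hS.exists_section p
  obtain ⟨hsp, hs0, hspan⟩ := hs.self_of_nhds
  have hloc : IsLocalSection S s p :=
    ⟨hs.mono fun q hq => hq.2.2 ▸ Submodule.mem_span_singleton_self _, hs.mono fun q hq => hq.1⟩
  have hz : ∀ᶠ q in 𝓝 p, star (s q) ⬝ᵥ (H q *ᵥ s q) = 0 := by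
    filter_upwards [hs, hO.mem_nhds hp] with q ⟨_, hq0, hqspan⟩ hq
    exact (eq_sharp_iff hqspan hq0 (hH.det_ne_zero q)).1 (heq q hq)
  obtain ⟨v, hv⟩ := hφ p s hloc hs0
  refine hv ?_
  have hre := hH.re_eq_zero hsp hz v
  have hre' := hH.re_eq_zero hsp hz (complexStr p v)
  have hol := hhol p s hloc v
  rw [heq p hp] at hol ⊢
  rw [mem_sharp_iff hspan] at hol ⊢
  rw [Matrix.mulVec_smul, Matrix.mulVec_add, Matrix.mulVec_smul, dotProduct_smul, dotProduct_add,
    dotProduct_smul, smul_eq_mul, smul_eq_mul] at hol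
  -- Now `⟨s, ∇_v s⟩ + i ⟨s, ∇_{iv} s⟩ = 0` with both pairings imaginary: the first summand is
  -- imaginary and the second is real, so each vanishes.
  have h1 := (mul_eq_zero.1 hol).resolve_left (by norm_num)
  have h2 := congrArg Complex.im h1
  simp only [Complex.add_im, Complex.mul_im, Complex.I_re, Complex.I_im, zero_mul, one_mul,
    hre', add_zero] at h2
  exact Complex.ext hre h2

end Main

end Oper

end

theorem mainTheorem6 {X : Type*} [TopologicalSpace X] [T2Space X] [CompactSpace X]
    [ConnectedSpace X] [ChartedSpace ℂ X] [IsManifold 𝓘(ℂ, ℂ) ω X]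
    (A : Oper.MatForm X) (S : X → Submodule ℂ Oper.Fib) (hA : Oper.IsRealOper A S) :
    (∃ H : X → Oper.Mat, Oper.IsParallelMetric A H) ∧
    (∃ h : X → Oper.Mat, Oper.IsRealityGauge A h) ∧
    ∀ (H h : X → Oper.Mat), Oper.IsParallelMetric A H → Oper.IsRealityGauge A h →
      (∀ (L : X → Submodule ℂ Oper.Fib), Oper.IsLineSubbundle L →
        ∀ (hc : ∀ p, IsCompl (S p) (L p)) (p : X), S p ≠ Oper.sharp H S p →
          Oper.InBigCell (Oper.gaugeLoop (hc p) (h p))) ∧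
      IsOpen {p : X | S p ≠ Oper.sharp H S p} ∧
      Dense {p : X | S p ≠ Oper.sharp H S p} := by
  have := Oper.isManifold_real (X := X)
  obtain ⟨H₀, hH₀⟩ := Oper.exists_isParallelMetric hA.smooth hA.traceFree hA.flat hA.realMonodromy
  obtain ⟨c₀, hc₀⟩ := Oper.exists_isRealityGauge_of_metric hA.traceFree hH₀
  refine ⟨⟨H₀, hH₀⟩, ⟨_, hc₀⟩, fun H h hH hh => ⟨fun L hL hc p hp => ?_,
    Oper.isOpen_ne_sharp hH hA.lineSubbundle,
    Oper.dense_ne_sharp hH hA.lineSubbundle hA.holomorphic hA.secondForm⟩⟩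
  obtain ⟨c, hhc⟩ := hh.eq_smul hA.smooth hA.traceFree hA.flat hA.irreducible hH
  obtain ⟨s, hs⟩ := hA.lineSubbundle.exists_section p
  obtain ⟨l, hl⟩ := hL.exists_section p
  obtain ⟨-, hs0, hspan⟩ := hs.self_of_nhds
  obtain ⟨-, hl0, hlspan⟩ := hl.self_of_nhds
  refine Oper.inBigCell_gaugeLoop (Hp := H p) (hc p) (s := s p) (l := l p) ?_ ?_ hs0 hl0
    (fun h0 => hp ((Oper.eq_sharp_iff hspan hs0 (hH.det_ne_zero p)).2 h0)) (hh.det_eq_one p) (hhc p)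
  · rw [hspan]
    exact Submodule.mem_span_singleton_self _
  · rw [hlspan]
    exact Submodule.mem_span_singleton_self _
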